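/- Let $\alpha>0$ and $0<p<\infty$. Let $m$ be Lebesgue measure on $\mathbb{C}$. Let $\mathcal F^p_\alpha$ be the space of entire functions $f$ with $$\|f\|_{(p,\alpha)}^p=\frac{\alpha p}{2\pi}\int_{\mathbb C}|f(z)|^p e^{-\frac{\alpha p}{2}|z|^2}\,dm(z)<\infty ,$$ and let $\mathcal F^\infty_\alpha$ be the space of entire functions $f$ with $$\|f\|_{(\infty,\alpha)}=\sup_{z\in\mathbb C}|f(z)|e^{-\frac{\alpha}{2}|z|^2}<\infty .$$ For entire functions $g,\psi$ and $f$ put $$V_{(g,\psi)}f(z)=\int_0^z f(\psi(w))\,g'(w)\,dw ,\qquad k_{(w,\alpha)}(z)=e^{\alpha z\overline{w}-\frac{\alpha}{2}|w|^2},$$ $$B_{(\psi,\alpha)}(|g|^p)(w)=\int_{\mathbb C}\frac{|k_{(w,\alpha)}(\psi(z))\,g'(z)|^p}{\big((1+|z|)e^{\frac{\alpha}{2}|z|^2}\big)^p}\,dm(z)\in[0,\infty].$$ Then, for all entire functions $g$ and $\psi$, the following are equivalent: 1. $V_{(g,\psi)}$ is a bounded operator from $\mathcal F^\infty_\alpha$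 to $\mathcal F^p_\alpha$; 2. $V_{(g,\psi)}$ is a compact operator from $\mathcal F^\infty_\alpha$ to $\mathcal F^p_\alpha$, i.e. it maps $\mathcal F^\infty_\alpha$ into $\mathcal F^p_\alpha$ and the image of every bounded sequence has a subsequence converging in $\mathcal F^p_\alpha$; 3. $B_{(\psi,\alpha)}(|g|^p)\in L^1(\mathbb C,dm)$. Moreover, there are constants $c,C>0$, depending only on $\alpha$ and $p$, such that for all entire $g$ and $\psi$ for which $V_{(g,\psi)}:\mathcal F^\infty_\alpha\to\mathcal F^p_\alpha$ is bounded, $$c\int_{\mathbb C}B_{(\psi,\alpha)}(|g|^p)\,dm\;\le\;\|V_{(g,\psi)}\|^p\;\le\;C\int_{\mathbb C}B_{(\psi,\alpha)}(|g|^p)\,dm ,$$ where $\|V_{(g,\psi)}\|=\sup\{\|V_{(g,\psi)}f\|_{(p,\alpha)}: f\in\mathcal F^\infty_\alpha,\ \|f\|_{(\infty,\alpha)}\le 1\}$. -/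

import Mathlib

open MeasureTheory Filter Topology
open scoped ENNReal NNReal ComplexConjugate

/-- The (extended) Fock (quasi-)norm for a finite exponent `p > 0`: its `p`-th power is
`(α p / 2π) ∫ |f(z)|^p exp(-(α p / 2) |z|²) dm(z)`, with value `∞` if the integral diverges. -/
noncomputable def fockENorm (α p : ℝ) (f : ℂ → ℂ) : ℝ≥0∞ :=
  (ENNReal.ofReal (α * p / (2 * Real.pi)) *
    ∫⁻ z : ℂ, ENNReal.ofReal (‖f z‖ ^ p * Real.exp (-(α * p / 2) * ‖z‖ ^ 2))) ^ (1 / p)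

/-- The (extended) norm of the growth space: `sup_z |f(z)| exp(-(α/2) |z|²)`. -/
noncomputable def fockENormTop (α : ℝ) (f : ℂ → ℂ) : ℝ≥0∞ :=
  ⨆ z : ℂ, ENNReal.ofReal (‖f z‖ * Real.exp (-(α / 2) * ‖z‖ ^ 2))

/-- The Fock space `F^p_α`, `0 < p < ∞`: entire functions of finite Fock norm. -/
def fockSpace (α p : ℝ) : Set (ℂ → ℂ) :=
  {f | Differentiable ℂ f ∧ fockENorm α p f < ∞}

/-- The growth space `F^∞_α`: entire functions of finite growth norm. -/
def fockSpaceTop (α : ℝ) : Set (ℂ → ℂ) :=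
  {f | Differentiable ℂ f ∧ fockENormTop α f < ∞}

/-- The Volterra type integral operator `V_g h (z) = ∫_0^z h(w) g'(w) dw`, the integral being taken
along the segment `w = t z`, `0 ≤ t ≤ 1` (it is path independent for entire `g`, `h`). -/
noncomputable def volterra (g h : ℂ → ℂ) (z : ℂ) : ℂ :=
  ∫ t in (0 : ℝ)..1, h (t * z) * deriv g (t * z) * z

/-- `V_{(g,ψ)} = V_g ∘ C_ψ`, that is `V_{(g,ψ)} f (z) = ∫_0^z f(ψ(w)) g'(w) dw`. -/
noncomputable def volterraComp (g ψ f : ℂ → ℂ) : ℂ → ℂ :=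
  volterra g (f ∘ ψ)

/-- `T` is a bounded operator from `F^∞_α` to `F^p_α`. -/
def FockBounded (α p : ℝ) (T : (ℂ → ℂ) → (ℂ → ℂ)) : Prop :=
  (∀ f ∈ fockSpaceTop α, T f ∈ fockSpace α p) ∧
    ∃ C : ℝ≥0, ∀ f ∈ fockSpaceTop α, fockENorm α p (T f) ≤ C * fockENormTop α f

/-- `T` is a compact operator from `F^∞_α` to `F^p_α`: it maps every bounded sequence of `F^∞_α`
to a sequence of `F^p_α` with a subsequence that converges in `F^p_α`. -/
def FockCompact (α p : ℝ) (T : (ℂ → ℂ) → (ℂ → ℂ)) : Prop :=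
  (∀ f ∈ fockSpaceTop α, T f ∈ fockSpace α p) ∧
    ∀ f : ℕ → ℂ → ℂ, (∀ n, f n ∈ fockSpaceTop α) →
      (∃ M : ℝ≥0, ∀ n, fockENormTop α (f n) ≤ M) →
      ∃ h ∈ fockSpace α p, ∃ φ : ℕ → ℕ, StrictMono φ ∧
        Tendsto (fun n => fockENorm α p (T (f (φ n)) - h)) atTop (𝓝 0)

/-- The operator norm of `T : F^∞_α → F^p_α`: the supremum of the norm of `T f` over the closed
unit ball of `F^∞_α`. -/
noncomputable def fockOpENorm (α p : ℝ) (T : (ℂ → ℂ) → (ℂ → ℂ)) : ℝ≥0∞ :=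
  ⨆ f ∈ {f ∈ fockSpaceTop α | fockENormTop α f ≤ 1}, fockENorm α p (T f)

/-- The normalized reproducing kernel `k_{(w,α)}(z) = exp(α ⟨z, w⟩ - α |w|² / 2)`,
with `⟨z, w⟩ = z * conj w`. -/
noncomputable def fockKernel (α : ℝ) (w z : ℂ) : ℂ :=
  Complex.exp (α * (z * conj w) - α * (‖w‖ : ℂ) ^ 2 / 2)

/-- The Berezin type transform `B_{(ψ,α)}(|g|^p)(w)`, with value `∞` where the defining integral
of a nonnegative function diverges. -/
noncomputable def fockBerezin (α p : ℝ) (g ψ : ℂ → ℂ) (w : ℂ) : ℝ≥0∞ :=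
  ∫⁻ z : ℂ, ENNReal.ofReal
    (‖fockKernel α w (ψ z) * deriv g z‖ ^ p /
      ((1 + ‖z‖) * Real.exp (α / 2 * ‖z‖ ^ 2)) ^ p)

/-!
For entire `h` with `h 0 = 0` the Fock norm has a Littlewood–Paley description
`∫ |h|^p exp(-αp/2 |z|²) ≍ ∫ |h'|^p (1 + |z|)^(-p) exp(-αp/2 |z|²)`, valid for all `0 < p < ∞`
(`exists_lintegral_deriv_le` and `exists_lintegral_le_deriv`). Since `(V_{(g,ψ)} f)' = (f ∘ ψ) g'`,
the norm of `V_{(g,ψ)} f` in `F^p_α` is comparable to `volterraEnergy`, the `L^p` norm of `f ∘ ψ`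
with respect to the measure `|g'|^p (1 + |z|)^(-p) exp(-αp/2 |z|²) dm`. Integrating the Gaussian
`w ↦ |k_w(ζ)|^p` shows that `∫ B_{(ψ,α)}(|g|^p) dm` is a constant multiple of `symbolMass`, the
integral of `exp(αp/2 |ψ|²)` against the same measure (`lintegral_fockBerezin`).

As `|f(ζ)| ≤ ‖f‖ exp(α/2 |ζ|²)` for `f ∈ F^∞_α`, finite `symbolMass` gives boundedness with the upper
estimate of the norm; it also gives a dominating function, so that a normal family argument
(`exists_subseq_tendsto_of_forall_norm_le`) and dominated convergence give compactness. Conversely,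
translates of a Jacobi theta function provide finitely many functions in the unit ball of `F^∞_α`, one
of which is at least `δ exp(α/2 |ζ|²)` at any given point `ζ` (`exists_finset_fock_lower_bound`).
Adding up the energies of these functions bounds `symbolMass`, so already the inclusion
`V_{(g,ψ)} F^∞_α ⊆ F^p_α` forces it to be finite.

In the Littlewood–Paley estimate, the bound for `h'` is Cauchy's inequality on the disc of radius
`1 / (1 + |z|)`, on which the weight is essentially constant, combined with the sub-mean value
inequality for `|h|^p`. The converse bound compares `h z` with `h z'`, where
`z' = √(1 - a / |z|²) z`. The map `z ↦ z'` preserves area and takes the weight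
`exp(-αp/2 |z'|²)` to exactly `exp(αp a / 2)` times its value at `z`, so for a suitable `a` the
contribution of `h z'` to the integral can be absorbed into the left-hand side, while
`|h z - h z'|` is controlled by `|h'|` at distance `O(1 / (1 + |z|))` from `z`.
-/

/-! ### Polar coordinates and mean values -/

theorem lintegral_polar {F : ℂ → ℝ≥0∞} (hF : Measurable F) :
    ∫⁻ z, F z = ∫⁻ r in Set.Ioi (0 : ℝ), ∫⁻ θ in Set.Ioo (-Real.pi) Real.pi,
      ENNReal.ofReal r * F (circleMap 0 r θ) := by
  rw [← Complex.lintegral_comp_polarCoord_symm, polarCoord_target, Measure.volume_eq_prod,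
    ← Measure.prod_restrict, lintegral_prod]
  · refine lintegral_congr fun r => lintegral_congr fun θ => ?_
    simp only [Complex.polarCoord_symm_apply, smul_eq_mul, circleMap, Complex.exp_mul_I, zero_add]
    simp
  · apply Measurable.aemeasurable
    have h : Measurable fun x : ℝ × ℝ => Complex.polarCoord.symm x := by
      simp only [Complex.polarCoord_symm_apply]
      fun_prop
    exact (ENNReal.measurable_ofReal.comp measurable_fst).smul (hF.comp h)

theorem norm_le_lintegral_circle {f : ℂ → ℂ} (hf : Differentiable ℂ f) (w : ℂ) (r : ℝ) :
    ENNReal.ofReal (2 * Real.pi) * ENNReal.ofReal ‖f w‖ ≤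
      ∫⁻ θ in Set.Ioo (-Real.pi) Real.pi, ENNReal.ofReal ‖f (circleMap w r θ)‖ := by
  have h1 : f w = (2 * Real.pi)⁻¹ • ∫ θ in -Real.pi..Real.pi, f (circleMap w r θ) := by
    have h := (hf.diffContOnCl (s := Metric.ball w |r|)).circleAverage
    rw [Real.circleAverage] at h
    rw [← h]
    have hper : Function.Periodic (fun θ => f (circleMap w r θ)) (2 * Real.pi) := fun θ => by
      simp only [periodic_circleMap w r θ]
    have := hper.intervalIntegral_add_eq 0 (-Real.pi)
    rw [zero_add, show -Real.pi + 2 * Real.pi = Real.pi by ring] at this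
    rw [this]
  have h2 : (2 * Real.pi) * ‖f w‖ = ‖∫ θ in -Real.pi..Real.pi, f (circleMap w r θ)‖ := by
    conv_lhs => rw [h1]
    have := Real.pi_pos
    rw [norm_smul, norm_inv, Real.norm_of_nonneg (by positivity)]
    field_simp
  rw [← ENNReal.ofReal_mul (by positivity), h2, ofReal_norm,
    intervalIntegral.integral_of_le (by linarith [Real.pi_pos]), ← restrict_Ioo_eq_restrict_Ioc]
  refine (enorm_integral_le_lintegral_enorm _).trans (le_of_eq ?_)
  simp only [ofReal_norm]

/-- The area version of the mean value inequality, obtained by integrating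
`norm_le_lintegral_circle` over the radius. -/
theorem norm_le_lintegral_ball {f : ℂ → ℂ} (hf : Differentiable ℂ f) (w : ℂ) {ρ : ℝ} (hρ : 0 < ρ) :
    ENNReal.ofReal (Real.pi * ρ ^ 2) * ENNReal.ofReal ‖f w‖ ≤
      ∫⁻ z in Metric.ball w ρ, ENNReal.ofReal ‖f z‖ := by
  have hm : Measurable (fun z => ENNReal.ofReal ‖f z‖) :=
    (hf.continuous.norm.measurable).ennreal_ofReal
  have hm' : Measurable ((Metric.ball w ρ).indicator (fun z => ENNReal.ofReal ‖f z‖)) :=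
    hm.indicator Metric.isOpen_ball.measurableSet
  rw [← lintegral_indicator Metric.isOpen_ball.measurableSet, ← lintegral_add_left_eq_self _ w,
    lintegral_polar (F := fun x => (Metric.ball w ρ).indicator
      (fun z => ENNReal.ofReal ‖f z‖) (w + x)) (hm'.comp (measurable_const_add w))]
  have h1 : ∀ r ∈ Set.Ioi (0 : ℝ), (Set.Iio ρ).indicator (fun r => ENNReal.ofReal r *
      (ENNReal.ofReal (2 * Real.pi) * ENNReal.ofReal ‖f w‖)) r ≤
      ∫⁻ θ in Set.Ioo (-Real.pi) Real.pi, ENNReal.ofReal r *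
        (Metric.ball w ρ).indicator (fun z => ENNReal.ofReal ‖f z‖) (w + circleMap 0 r θ) := by
    intro r hr
    by_cases hrρ : r < ρ
    · rw [Set.indicator_of_mem (by exact hrρ), lintegral_const_mul']
      · gcongr
        refine (norm_le_lintegral_circle hf w r).trans (le_of_eq (lintegral_congr fun θ => ?_))
        have : w + circleMap 0 r θ = circleMap w r θ := by simp [circleMap]
        rw [this, Set.indicator_of_mem]
        have h0 : (0 : ℝ) < r := hr
        rw [Metric.mem_ball, Complex.dist_eq, circleMap_sub_center, norm_circleMap_zero,
          abs_of_pos h0]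
        exact hrρ
      · exact ENNReal.ofReal_ne_top
    · rw [Set.indicator_of_notMem (by simpa using hrρ)]
      exact zero_le
  refine le_trans ?_ (setLIntegral_mono' measurableSet_Ioi h1)
  rw [lintegral_indicator measurableSet_Iio, Measure.restrict_restrict measurableSet_Iio,
    Set.Iio_inter_Ioi, lintegral_mul_const _ (by fun_prop)]
  have h2 : ∫⁻ r in Set.Ioo 0 ρ, ENNReal.ofReal r = ENNReal.ofReal (ρ ^ 2 / 2) := by
    rw [restrict_Ioo_eq_restrict_Ioc, ← ofReal_integral_eq_lintegral_ofReal,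
      ← intervalIntegral.integral_of_le hρ.le, integral_id]
    · simp
    · exact (continuous_id.integrableOn_Icc).mono_set Set.Ioc_subset_Icc_self
    · exact (ae_restrict_iff' measurableSet_Ioc).2 (Eventually.of_forall fun r hr => hr.1.le)
  rw [h2, ← mul_assoc, ← ENNReal.ofReal_mul (by positivity : (0 : ℝ) ≤ ρ ^ 2 / 2),
    show ρ ^ 2 / 2 * (2 * Real.pi) = Real.pi * ρ ^ 2 by ring]

/-- The radial map `z ↦ √(1 - a / |z|²) z` of `{|z|² > a}` onto the punctured plane preserves area:
it subtracts `a` from `|z|²`, and the area element is `½ d(|z|²) dθ`. -/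
theorem lintegral_comp_radial {a : ℝ} (ha : 0 < a) {F : ℂ → ℝ≥0∞} (hF : Measurable F) :
    ∫⁻ z in {z : ℂ | a < ‖z‖ ^ 2}, F (((√(1 - a / ‖z‖ ^ 2) : ℝ) : ℂ) * z) = ∫⁻ z, F z := by
  have hS : MeasurableSet {z : ℂ | a < ‖z‖ ^ 2} := measurableSet_lt (by fun_prop) (by fun_prop)
  have hm : Measurable fun z : ℂ => F (((√(1 - a / ‖z‖ ^ 2) : ℝ) : ℂ) * z) :=
    hF.comp (by fun_prop)
  rw [← lintegral_indicator hS, lintegral_polar (hm.indicator hS), lintegral_polar hF]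
  set G : ℝ → ℝ≥0∞ := fun r => ∫⁻ θ in Set.Ioo (-Real.pi) Real.pi, F (circleMap 0 r θ) with hG
  have hsub : (Set.Ioi √a) ⊆ Set.Ioi 0 := Set.Ioi_subset_Ioi (Real.sqrt_nonneg a)
  have hpos : ∀ r ∈ Set.Ioi √a, 0 < r ^ 2 - a := fun r hr => by
    have := (Real.sqrt_lt' (hsub hr)).1 hr
    linarith
  have h1 : ∀ r ∈ Set.Ioi (0 : ℝ), ∫⁻ θ in Set.Ioo (-Real.pi) Real.pi, ENNReal.ofReal r *
      {z : ℂ | a < ‖z‖ ^ 2}.indicator (fun z => F (((√(1 - a / ‖z‖ ^ 2) : ℝ) : ℂ) * z))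
        (circleMap 0 r θ) =
      (Set.Ioi √a).indicator (fun r => ENNReal.ofReal r * G (√(r ^ 2 - a))) r := by
    intro r hr
    have hr0 : (0 : ℝ) < r := hr
    have hnorm : ∀ θ, ‖circleMap 0 r θ‖ = r := fun θ => by simp [abs_of_pos hr0]
    rw [lintegral_const_mul' _ _ ENNReal.ofReal_ne_top]
    by_cases har : √a < r
    · have har2 : a < r ^ 2 := (Real.sqrt_lt' hr0).1 har
      rw [Set.indicator_of_mem (by exact har)]
      congr 1
      refine lintegral_congr fun θ => ?_
      rw [Set.indicator_of_mem (by simpa [hnorm] using har2), hnorm]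
      congr 1
      have : √(r ^ 2 - a) = √(1 - a / r ^ 2) * r := by
        rw [show r ^ 2 - a = (1 - a / r ^ 2) * r ^ 2 by field_simp, Real.sqrt_mul',
          Real.sqrt_sq hr0.le]
        positivity
      rw [this]
      simp [circleMap, mul_assoc]
    · have har2 : ¬ a < r ^ 2 := fun h => har ((Real.sqrt_lt' hr0).2 h)
      rw [Set.indicator_of_notMem (by exact har)]
      have : ∀ θ, {z : ℂ | a < ‖z‖ ^ 2}.indicator
          (fun z => F (((√(1 - a / ‖z‖ ^ 2) : ℝ) : ℂ) * z)) (circleMap 0 r θ) = 0 := fun θ =>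
        Set.indicator_of_notMem (by simpa only [Set.mem_ofPred_eq, hnorm] using har2) _
      simp [this]
  rw [setLIntegral_congr_fun measurableSet_Ioi h1, lintegral_indicator measurableSet_Ioi,
    Measure.restrict_restrict measurableSet_Ioi, Set.inter_eq_self_of_subset_left hsub]
  have himg : (fun r : ℝ => √(r ^ 2 - a)) '' Set.Ioi √a = Set.Ioi 0 := by
    ext s
    constructor
    · rintro ⟨r, hr, rfl⟩
      exact Real.sqrt_pos.2 (hpos r hr)
    · intro hs
      have hs0 : (0 : ℝ) < s := hs
      refine ⟨√(s ^ 2 + a), Real.sqrt_lt_sqrt ha.le (by nlinarith), ?_⟩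
      beta_reduce
      rw [Real.sq_sqrt (by positivity), add_sub_cancel_right, Real.sqrt_sq hs0.le]
  have hder : ∀ r ∈ Set.Ioi √a, HasDerivWithinAt (fun r : ℝ => √(r ^ 2 - a))
      (r / √(r ^ 2 - a)) (Set.Ioi √a) r := by
    intro r hr
    have := (((hasDerivAt_pow 2 r).sub_const a).sqrt (hpos r hr).ne').hasDerivWithinAt
      (s := Set.Ioi √a)
    refine this.congr_deriv ?_
    push_cast
    rw [pow_one, mul_div_mul_left _ _ two_ne_zero]
  have hinj : Set.InjOn (fun r : ℝ => √(r ^ 2 - a)) (Set.Ioi √a) := by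
    intro r hr s hs h
    beta_reduce at h
    rw [Real.sqrt_inj (hpos r hr).le (hpos s hs).le] at h
    have h' : r ^ 2 = s ^ 2 := by linarith
    exact (pow_left_inj₀ (hsub hr).le (hsub hs).le two_ne_zero).1 h'
  have key := lintegral_image_eq_lintegral_abs_deriv_mul measurableSet_Ioi hder hinj
    (fun s => ENNReal.ofReal s * G s)
  rw [himg] at key
  have h3 : ∀ r, ∫⁻ θ in Set.Ioo (-Real.pi) Real.pi, ENNReal.ofReal r * F (circleMap 0 r θ) =
      ENNReal.ofReal r * G r := fun r => lintegral_const_mul' _ _ ENNReal.ofReal_ne_top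
  simp only [h3]
  rw [key]
  refine setLIntegral_congr_fun measurableSet_Ioi fun r hr => ?_
  have hs := Real.sqrt_pos.2 (hpos r hr)
  rw [← mul_assoc, ← ENNReal.ofReal_mul (abs_nonneg _),
    abs_of_nonneg (div_nonneg (hsub hr).le hs.le), div_mul_cancel₀ _ hs.ne']

/-! ### Local `L^p` bounds for entire functions -/

/-- The sub-mean value inequality for `|f|^p`, `p ≤ 1`, up to a constant. It follows from the case
`p = 1` by evaluating at a point that maximizes `(r - |w - z|)² |f w|^p`: on a disc around it `|f|` is
comparable to its value at the centre, so that `|f|` can be replaced by `|f|^p` in the integrand. -/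
theorem exists_rpow_norm_le_lintegral_ball_of_le_one {p : ℝ} (hp : 0 < p) (hp1 : p ≤ 1) :
    ∃ C : ℝ, 0 < C ∧ ∀ f : ℂ → ℂ, Differentiable ℂ f → ∀ (z : ℂ) (r : ℝ), 0 < r →
      ENNReal.ofReal (r ^ 2 * ‖f z‖ ^ p) ≤
        ENNReal.ofReal C * ∫⁻ w in Metric.ball z r, ENNReal.ofReal (‖f w‖ ^ p) := by
  set K : ℝ := (4 : ℝ) ^ (1 / p) with hK
  have hK0 : 0 < K := by positivity
  have hKp : K ^ p = 4 := by
    rw [hK, ← Real.rpow_mul (by norm_num), one_div_mul_cancel hp.ne', Real.rpow_one]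
  refine ⟨4 * K ^ (1 - p), by positivity, fun f hf z r hr => ?_⟩
  have hcont : Continuous fun w => ‖f w‖ ^ p := hf.continuous.norm.rpow_const fun _ => Or.inr hp.le
  obtain ⟨w₀, hw₀, hmax⟩ := (isCompact_closedBall z r).exists_isMaxOn
    ⟨z, Metric.mem_closedBall_self hr.le⟩
    (f := fun w => (r - dist w z) ^ 2 * ‖f w‖ ^ p) (by fun_prop)
  have hz : r ^ 2 * ‖f z‖ ^ p ≤ (r - dist w₀ z) ^ 2 * ‖f w₀‖ ^ p := by
    simpa using hmax (Metric.mem_closedBall_self hr.le)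
  -- if the maximum vanishes, then so does `f z`
  rcases (norm_nonneg (f w₀)).eq_or_lt with h0 | h0
  · rw [← h0, Real.zero_rpow hp.ne', mul_zero] at hz
    rw [ENNReal.ofReal_of_nonpos hz]
    exact zero_le
  rcases (sub_nonneg.2 (Metric.mem_closedBall.1 hw₀)).eq_or_lt with hd | hd
  · rw [← hd] at hz
    rw [ENNReal.ofReal_of_nonpos (by simpa using hz)]
    exact zero_le
  obtain ⟨ρ, hρ, hρd⟩ : ∃ ρ : ℝ, 0 < ρ ∧ r - dist w₀ z = 2 * ρ :=
    ⟨(r - dist w₀ z) / 2, by positivity, by ring⟩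
  have hsub : Metric.ball w₀ ρ ⊆ Metric.ball z r := by
    apply Metric.ball_subset_ball'
    linarith
  -- on the smaller disc `|f|` exceeds its value at the centre at most by the factor `K`
  have hbd : ∀ w ∈ Metric.ball w₀ ρ, ‖f w‖ ≤ K * ‖f w₀‖ := by
    intro w hw
    have h1 := hmax (Metric.ball_subset_closedBall (hsub hw))
    simp only [hρd] at h1
    have h2 : ρ ≤ r - dist w z := by
      have := dist_triangle w w₀ z
      have := Metric.mem_ball.1 hw
      linarith
    have h3 : ρ ^ 2 * ‖f w‖ ^ p ≤ (r - dist w z) ^ 2 * ‖f w‖ ^ p := by gcongr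
    have h4 : ‖f w‖ ^ p ≤ 4 * ‖f w₀‖ ^ p := by
      have : ρ ^ 2 * ‖f w‖ ^ p ≤ ρ ^ 2 * (4 * ‖f w₀‖ ^ p) := by
        refine h3.trans (h1.trans (le_of_eq ?_))
        ring
      exact le_of_mul_le_mul_left this (by positivity)
    rw [← hKp, ← Real.mul_rpow hK0.le (norm_nonneg _)] at h4
    exact (Real.rpow_le_rpow_iff (norm_nonneg _) (by positivity) hp).1 h4
  have h5 : ENNReal.ofReal (Real.pi * ρ ^ 2) * ENNReal.ofReal ‖f w₀‖ ≤
      ENNReal.ofReal ((K * ‖f w₀‖) ^ (1 - p)) *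
        ∫⁻ w in Metric.ball z r, ENNReal.ofReal (‖f w‖ ^ p) := by
    refine (norm_le_lintegral_ball hf w₀ hρ).trans ?_
    rw [← lintegral_const_mul' _ _ ENNReal.ofReal_ne_top]
    refine le_trans (setLIntegral_mono' Metric.isOpen_ball.measurableSet fun w hw => ?_)
      (lintegral_mono_set hsub)
    rw [← ENNReal.ofReal_mul (by positivity)]
    apply ENNReal.ofReal_le_ofReal
    rcases (norm_nonneg (f w)).eq_or_lt with h | h
    · rw [← h]; positivity
    calc ‖f w‖ = ‖f w‖ ^ (1 - p) * ‖f w‖ ^ p := by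
          rw [← Real.rpow_add h, sub_add_cancel, Real.rpow_one]
      _ ≤ _ := by
          exact mul_le_mul_of_nonneg_right
            (Real.rpow_le_rpow h.le (hbd w hw) (by linarith)) (by positivity)
  set A := ∫⁻ w in Metric.ball z r, ENNReal.ofReal (‖f w‖ ^ p)
  have hc : 0 < ‖f w₀‖ ^ (1 - p) := by positivity
  have h6 : ENNReal.ofReal (‖f w₀‖ ^ (1 - p)) * ENNReal.ofReal (Real.pi * ρ ^ 2 * ‖f w₀‖ ^ p) ≤
      ENNReal.ofReal (‖f w₀‖ ^ (1 - p)) * (ENNReal.ofReal (K ^ (1 - p)) * A) := by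
    rw [← ENNReal.ofReal_mul hc.le, ← mul_assoc (ENNReal.ofReal _) (ENNReal.ofReal _) A,
      ← ENNReal.ofReal_mul (q := K ^ (1 - p)) hc.le]
    rw [← ENNReal.ofReal_mul (by positivity), Real.mul_rpow hK0.le h0.le] at h5
    convert h5 using 2
    · rw [show ‖f w₀‖ ^ (1 - p) * (Real.pi * ρ ^ 2 * ‖f w₀‖ ^ p) =
        Real.pi * ρ ^ 2 * (‖f w₀‖ ^ (1 - p) * ‖f w₀‖ ^ p) by ring, ← Real.rpow_add h0,
        sub_add_cancel, Real.rpow_one]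
    · rw [mul_comm]
  rw [ENNReal.mul_le_mul_iff_right (by simpa using hc) ENNReal.ofReal_ne_top] at h6
  calc ENNReal.ofReal (r ^ 2 * ‖f z‖ ^ p) ≤
        ENNReal.ofReal (4 * (Real.pi * ρ ^ 2 * ‖f w₀‖ ^ p)) := by
        apply ENNReal.ofReal_le_ofReal
        refine hz.trans ?_
        rw [hρd]
        have : 1 * (ρ ^ 2 * ‖f w₀‖ ^ p) ≤ Real.pi * (ρ ^ 2 * ‖f w₀‖ ^ p) := by
          gcongr
          linarith [Real.pi_gt_three]
        nlinarith
    _ = ENNReal.ofReal 4 * ENNReal.ofReal (Real.pi * ρ ^ 2 * ‖f w₀‖ ^ p) :=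
        ENNReal.ofReal_mul (by norm_num)
    _ ≤ ENNReal.ofReal 4 * (ENNReal.ofReal (K ^ (1 - p)) * A) := by gcongr
    _ = _ := by rw [← mul_assoc, ← ENNReal.ofReal_mul (by norm_num)]

/-- The sub-mean value inequality for `|f|^p` and all `p > 0`: apply the case `p / k ≤ 1` to the
entire function `f ^ k`. -/
theorem exists_rpow_norm_le_lintegral_ball {p : ℝ} (hp : 0 < p) :
    ∃ C : ℝ, 0 < C ∧ ∀ f : ℂ → ℂ, Differentiable ℂ f → ∀ (z : ℂ) (r : ℝ), 0 < r →
      ENNReal.ofReal (r ^ 2 * ‖f z‖ ^ p) ≤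
        ENNReal.ofReal C * ∫⁻ w in Metric.ball z r, ENNReal.ofReal (‖f w‖ ^ p) := by
  obtain ⟨k, hk⟩ := exists_nat_ge p
  have hk0 : (0 : ℝ) < k := hp.trans_le hk
  obtain ⟨C, hC, h⟩ := exists_rpow_norm_le_lintegral_ball_of_le_one (p := p / k) (by positivity)
    ((div_le_one hk0).2 hk)
  refine ⟨C, hC, fun f hf z r hr => ?_⟩
  have h1 := h (fun w => f w ^ k) (hf.pow k) z r hr
  have h2 : ∀ w, ‖f w ^ k‖ ^ (p / k) = ‖f w‖ ^ p := fun w => by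
    rw [norm_pow, ← Real.rpow_natCast, ← Real.rpow_mul (norm_nonneg _), mul_div_cancel₀ _ hk0.ne']
  simpa only [h2] using h1

/-! ### Averaging over discs of radius comparable to `1 / (1 + |z|)` -/

/-- The weight `(1 + |z|)^q exp(-b |z|²)`. -/
noncomputable def fockWeight (b q : ℝ) (z : ℂ) : ℝ := (1 + ‖z‖) ^ q * Real.exp (-b * ‖z‖ ^ 2)

/-- The integral of `|f|^p` over the disc of centre `z` and radius `ℓ / (1 + |z|)`, multiplied by
`(1 + |z|)²`; up to a constant, the average of `|f|^p` over this disc. -/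
noncomputable def localMass (p ℓ : ℝ) (f : ℂ → ℂ) (z : ℂ) : ℝ≥0∞ :=
  ENNReal.ofReal ((1 + ‖z‖) ^ 2) *
    ∫⁻ w in Metric.ball z (ℓ / (1 + ‖z‖)), ENNReal.ofReal (‖f w‖ ^ p)

theorem fockWeight_pos (b q : ℝ) (z : ℂ) : 0 < fockWeight b q z := by
  unfold fockWeight; positivity

theorem continuous_fockWeight (b q : ℝ) : Continuous (fockWeight b q) := by
  unfold fockWeight
  refine Continuous.mul ?_ (by fun_prop)
  exact (continuous_const.add continuous_norm).rpow_const fun z => Or.inl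
    (add_pos_of_pos_of_nonneg one_pos (norm_nonneg z)).ne'

theorem fockWeight_zero (b : ℝ) (z : ℂ) : fockWeight b 0 z = Real.exp (-b * ‖z‖ ^ 2) := by
  simp [fockWeight]

theorem dist_le_of_dist_le_div {ℓ : ℝ} (hℓ : 0 ≤ ℓ) {z w : ℂ}
    (h : dist w z ≤ ℓ / (1 + ‖z‖)) : dist w z ≤ ℓ :=
  h.trans (div_le_self hℓ (by linarith [norm_nonneg z]))

theorem one_add_norm_le_left {ℓ : ℝ} (hℓ : 0 ≤ ℓ) {z w : ℂ}
    (h : dist w z ≤ ℓ / (1 + ‖z‖)) : 1 + ‖w‖ ≤ (1 + ℓ) * (1 + ‖z‖) := by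
  have h1 := dist_le_of_dist_le_div hℓ h
  have h2 : ‖w‖ ≤ ‖z‖ + ‖w - z‖ := norm_le_norm_add_norm_sub' w z
  rw [Complex.dist_eq] at h1
  nlinarith [norm_nonneg z]

theorem one_add_norm_le_right {ℓ : ℝ} (hℓ : 0 ≤ ℓ) {z w : ℂ}
    (h : dist w z ≤ ℓ / (1 + ‖z‖)) : 1 + ‖z‖ ≤ (1 + ℓ) * (1 + ‖w‖) := by
  have h1 := dist_le_of_dist_le_div hℓ h
  have h2 : ‖z‖ ≤ ‖w‖ + ‖w - z‖ := norm_le_norm_add_norm_sub w z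
  rw [Complex.dist_eq] at h1
  nlinarith [norm_nonneg w]

theorem dist_le_div_symm {ℓ : ℝ} (hℓ : 0 ≤ ℓ) {z w : ℂ}
    (h : dist w z ≤ ℓ / (1 + ‖z‖)) : dist z w ≤ ℓ * (1 + ℓ) / (1 + ‖w‖) := by
  have h1 := one_add_norm_le_left hℓ h
  rw [dist_comm, le_div_iff₀ (by positivity)]
  rw [le_div_iff₀ (by positivity)] at h
  nlinarith [dist_nonneg (x := w) (y := z)]

theorem norm_sq_le_norm_sq_add {ℓ : ℝ} (hℓ : 0 ≤ ℓ) {z w : ℂ}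
    (h : dist w z ≤ ℓ / (1 + ‖z‖)) : ‖w‖ ^ 2 ≤ ‖z‖ ^ 2 + ℓ * (2 + ℓ) := by
  have h1 := dist_le_of_dist_le_div hℓ h
  have h2 : ‖w‖ ≤ ‖z‖ + ‖w - z‖ := norm_le_norm_add_norm_sub' w z
  rw [le_div_iff₀ (by positivity)] at h
  rw [Complex.dist_eq] at h1 h
  have h3 : 0 ≤ ‖w - z‖ := norm_nonneg _
  calc ‖w‖ ^ 2 ≤ (‖z‖ + ‖w - z‖) ^ 2 := by gcongr
    _ ≤ _ := by nlinarith [norm_nonneg z]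

/-- The weight is essentially constant on discs of radius comparable to `1 / (1 + |z|)`, as
`|z|²` varies by a bounded amount there. -/
theorem fockWeight_le {ℓ : ℝ} (hℓ : 0 ≤ ℓ) {z w : ℂ}
    (h : dist w z ≤ ℓ / (1 + ‖z‖))
    {b : ℝ} (hb : 0 ≤ b) (q : ℝ) :
    fockWeight b q z ≤ (1 + ℓ) ^ |q| * Real.exp (b * (ℓ * (2 + ℓ))) * fockWeight b q w := by
  have h1 := one_add_norm_le_left hℓ h
  have h2 := one_add_norm_le_right hℓ h
  have h3 := norm_sq_le_norm_sq_add hℓ h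
  have hz : 0 < 1 + ‖z‖ := by positivity
  have hw : 0 < 1 + ‖w‖ := by positivity
  have hl : 0 < 1 + ℓ := by positivity
  have h4 : (1 + ‖z‖) ^ q ≤ (1 + ℓ) ^ |q| * (1 + ‖w‖) ^ q := by
    rcases le_total 0 q with hq | hq
    · rw [abs_of_nonneg hq, ← Real.mul_rpow hl.le hw.le]
      exact Real.rpow_le_rpow hz.le h2 hq
    · rw [abs_of_nonpos hq, Real.rpow_neg hl.le, inv_mul_eq_div, le_div_iff₀ (by positivity),
        mul_comm, ← Real.mul_rpow hl.le hz.le]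
      exact Real.rpow_le_rpow_of_nonpos hw h1 hq
  have h5 : Real.exp (-b * ‖z‖ ^ 2) ≤
      Real.exp (b * (ℓ * (2 + ℓ))) * Real.exp (-b * ‖w‖ ^ 2) := by
    rw [← Real.exp_add]
    apply Real.exp_le_exp.2
    nlinarith
  unfold fockWeight
  calc _ ≤ ((1 + ℓ) ^ |q| * (1 + ‖w‖) ^ q) *
        (Real.exp (b * (ℓ * (2 + ℓ))) * Real.exp (-b * ‖w‖ ^ 2)) := by gcongr
    _ = _ := by ring

/-- Local averaging is bounded on the weighted `L¹` space: by Tonelli's theorem, since the set of `z`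
whose disc contains a given `w` has area `O((1 + |w|)^(-2))`. -/
theorem exists_lintegral_localMass_le (p : ℝ) {b ℓ : ℝ} (hb : 0 ≤ b) (hℓ : 0 ≤ ℓ) (q : ℝ) :
    ∃ C : ℝ, 0 < C ∧ ∀ f : ℂ → ℂ, Measurable f →
      ∫⁻ z, ENNReal.ofReal (fockWeight b q z) * localMass p ℓ f z ≤
        ENNReal.ofReal C * ∫⁻ z, ENNReal.ofReal (‖f z‖ ^ p * fockWeight b q z) := by
  set K : ℝ := (1 + ℓ) ^ 2 * ((1 + ℓ) ^ |q| * Real.exp (b * (ℓ * (2 + ℓ)))) with hK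
  have hK0 : 0 < K := by positivity
  refine ⟨K * (Real.pi * ((ℓ * (1 + ℓ)) ^ 2 + 1)), by positivity, fun f hf => ?_⟩
  have hmf : Measurable fun w => ENNReal.ofReal (‖f w‖ ^ p) :=
    (hf.norm.pow_const p).ennreal_ofReal
  have hmw : Measurable fun z => ENNReal.ofReal (fockWeight b q z) :=
    (continuous_fockWeight b q).measurable.ennreal_ofReal
  set S : Set (ℂ × ℂ) := {x | dist x.2 x.1 < ℓ / (1 + ‖x.1‖)} with hS
  have hSm : MeasurableSet S := measurableSet_lt (by fun_prop) (by fun_prop)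
  set G : ℂ → ℂ → ℝ≥0∞ := fun z w => S.indicator (fun x => ENNReal.ofReal
    (K * ((1 + ‖x.2‖) ^ 2 * (‖f x.2‖ ^ p * fockWeight b q x.2)))) (z, w) with hG
  have hGm : Measurable (Function.uncurry G) := by
    refine Measurable.indicator ?_ hSm
    have := (continuous_fockWeight b q).measurable
    fun_prop
  have h1 : ∀ z, ENNReal.ofReal (fockWeight b q z) * localMass p ℓ f z ≤ ∫⁻ w, G z w := by
    intro z
    rw [localMass, ← mul_assoc, ← ENNReal.ofReal_mul (fockWeight_pos b q z).le,
      ← lintegral_const_mul' _ _ ENNReal.ofReal_ne_top,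
      ← lintegral_indicator Metric.isOpen_ball.measurableSet]
    refine lintegral_mono fun w => ?_
    by_cases hw : w ∈ Metric.ball z (ℓ / (1 + ‖z‖))
    · have hw' : dist w z ≤ ℓ / (1 + ‖z‖) := (Metric.mem_ball.1 hw).le
      rw [Set.indicator_of_mem hw]
      simp only [hG]
      rw [Set.indicator_of_mem (by exact hw), ← ENNReal.ofReal_mul
        (mul_nonneg (fockWeight_pos b q z).le (by positivity))]
      apply ENNReal.ofReal_le_ofReal
      have h2 := one_add_norm_le_right hℓ hw'
      have h3 := fockWeight_le hℓ hw' hb q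
      have := (fockWeight_pos b q z).le
      have := (fockWeight_pos b q w).le
      calc fockWeight b q z * (1 + ‖z‖) ^ 2 * ‖f w‖ ^ p ≤
          ((1 + ℓ) ^ |q| * Real.exp (b * (ℓ * (2 + ℓ))) * fockWeight b q w) *
            ((1 + ℓ) * (1 + ‖w‖)) ^ 2 * ‖f w‖ ^ p := by gcongr
        _ = _ := by rw [hK]; ring
    · rw [Set.indicator_of_notMem hw]
      exact zero_le
  refine (lintegral_mono h1).trans ?_
  rw [lintegral_lintegral_swap hGm.aemeasurable, ← lintegral_const_mul' _ _ ENNReal.ofReal_ne_top]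
  refine lintegral_mono fun w => ?_
  have hpos : 0 ≤ ‖f w‖ ^ p * fockWeight b q w :=
    mul_nonneg (by positivity) (fockWeight_pos b q w).le
  have h2 : ∀ z, G z w ≤ (Metric.closedBall w (ℓ * (1 + ℓ) / (1 + ‖w‖))).indicator
      (fun _ => ENNReal.ofReal (K * ((1 + ‖w‖) ^ 2 * (‖f w‖ ^ p * fockWeight b q w)))) z := by
    intro z
    by_cases hz : dist w z < ℓ / (1 + ‖z‖)
    · rw [Set.indicator_of_mem (Metric.mem_closedBall.2 (dist_le_div_symm hℓ hz.le))]
      simp only [hG]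
      rw [Set.indicator_of_mem (by exact hz)]
    · simp only [hG]
      rw [Set.indicator_of_notMem (by exact hz)]
      exact zero_le
  refine (lintegral_mono h2).trans ?_
  rw [lintegral_indicator_const Metric.isClosed_closedBall.measurableSet,
    Complex.volume_closedBall, ← ENNReal.ofReal_pow (by positivity),
    show (NNReal.pi : ℝ≥0∞) = ENNReal.ofReal Real.pi by
      rw [ENNReal.ofReal_eq_coe_nnreal Real.pi_pos.le]; rfl,
    ← ENNReal.ofReal_mul (by positivity), ← ENNReal.ofReal_mul (by positivity),
    ← ENNReal.ofReal_mul (by positivity)]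
  apply ENNReal.ofReal_le_ofReal
  calc _ = K * (Real.pi * (ℓ * (1 + ℓ)) ^ 2) * (‖f w‖ ^ p * fockWeight b q w) := by
        have : (1 + ‖w‖) ≠ 0 := by positivity
        field_simp
    _ ≤ _ := by gcongr; linarith

theorem exists_rpow_norm_le_localMass {p L : ℝ} (hp : 0 < p) :
    ∃ C : ℝ, 0 < C ∧ ∀ f : ℂ → ℂ, Differentiable ℂ f → ∀ z w : ℂ, dist w z ≤ L / (1 + ‖z‖) →
      ENNReal.ofReal (‖f w‖ ^ p) ≤ ENNReal.ofReal C * localMass p (L + 1) f z := by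
  obtain ⟨C, hC, h⟩ := exists_rpow_norm_le_lintegral_ball hp
  refine ⟨C, hC, fun f hf z w hw => ?_⟩
  have hz : 0 < 1 + ‖z‖ := by positivity
  have h1 := h f hf w (1 / (1 + ‖z‖)) (by positivity)
  have hsub : Metric.ball w (1 / (1 + ‖z‖)) ⊆ Metric.ball z ((L + 1) / (1 + ‖z‖)) := by
    apply Metric.ball_subset_ball'
    rw [add_div]
    linarith
  calc ENNReal.ofReal (‖f w‖ ^ p) = ENNReal.ofReal ((1 + ‖z‖) ^ 2) *
        ENNReal.ofReal ((1 / (1 + ‖z‖)) ^ 2 * ‖f w‖ ^ p) := by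
        rw [← ENNReal.ofReal_mul (by positivity)]
        congr 1
        field_simp
    _ ≤ ENNReal.ofReal ((1 + ‖z‖) ^ 2) * (ENNReal.ofReal C *
        ∫⁻ x in Metric.ball z ((L + 1) / (1 + ‖z‖)), ENNReal.ofReal (‖f x‖ ^ p)) := by
        gcongr
        exact h1.trans (by gcongr)
    _ = _ := by rw [localMass]; ring

/-- One half of the Littlewood–Paley estimate: the derivative is bounded by the function. -/
theorem exists_lintegral_deriv_le {p b : ℝ} (hp : 0 < p) (hb : 0 ≤ b) :
    ∃ C : ℝ, 0 < C ∧ ∀ h : ℂ → ℂ, Differentiable ℂ h →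
      ∫⁻ z, ENNReal.ofReal (‖deriv h z‖ ^ p * fockWeight b (-p) z) ≤
        ENNReal.ofReal C * ∫⁻ z, ENNReal.ofReal (‖h z‖ ^ p * fockWeight b 0 z) := by
  obtain ⟨C₁, hC₁, h1⟩ := exists_rpow_norm_le_localMass (L := 1) hp
  obtain ⟨C₂, hC₂, h2⟩ := exists_lintegral_localMass_le p hb (by norm_num : (0 : ℝ) ≤ 1 + 1) 0
  refine ⟨C₁ * C₂, by positivity, fun h hh => ?_⟩
  have h3 : ∀ z, ENNReal.ofReal (‖deriv h z‖ ^ p * fockWeight b (-p) z) ≤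
      ENNReal.ofReal C₁ * (ENNReal.ofReal (fockWeight b 0 z) * localMass p (1 + 1) h z) := by
    intro z
    have hz : 0 < 1 + ‖z‖ := by positivity
    obtain ⟨w, hw, hmax⟩ := (isCompact_sphere z (1 / (1 + ‖z‖))).exists_isMaxOn
      (NormedSpace.sphere_nonempty.2 (by positivity)) hh.continuous.norm.continuousOn
    have h4 := Complex.norm_deriv_le_of_forall_mem_sphere_norm_le (R := 1 / (1 + ‖z‖))
      (by positivity) hh.diffContOnCl (fun x hx => hmax hx)
    rw [div_div_eq_mul_div, div_one] at h4
    have h5 := h1 h hh z w (Metric.mem_sphere.1 hw).le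
    calc ENNReal.ofReal (‖deriv h z‖ ^ p * fockWeight b (-p) z) ≤
          ENNReal.ofReal (fockWeight b 0 z * ‖h w‖ ^ p) := by
          apply ENNReal.ofReal_le_ofReal
          have h6 : ‖deriv h z‖ ^ p ≤ ‖h w‖ ^ p * (1 + ‖z‖) ^ p := by
            rw [← Real.mul_rpow (norm_nonneg _) hz.le]
            exact Real.rpow_le_rpow (norm_nonneg _) h4 hp.le
          rw [fockWeight_zero, fockWeight, Real.rpow_neg hz.le]
          calc _ ≤ (‖h w‖ ^ p * (1 + ‖z‖) ^ p) *
                (((1 + ‖z‖) ^ p)⁻¹ * Real.exp (-b * ‖z‖ ^ 2)) := by gcongr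
            _ = _ := by field_simp
      _ = ENNReal.ofReal (fockWeight b 0 z) * ENNReal.ofReal (‖h w‖ ^ p) :=
          ENNReal.ofReal_mul (fockWeight_pos b 0 z).le
      _ ≤ ENNReal.ofReal (fockWeight b 0 z) * (ENNReal.ofReal C₁ * localMass p (1 + 1) h z) := by
          gcongr
      _ = _ := by ring
  refine (lintegral_mono h3).trans ?_
  rw [lintegral_const_mul' _ _ ENNReal.ofReal_ne_top, ENNReal.ofReal_mul hC₁.le, mul_assoc]
  gcongr
  exact h2 h hh.continuous.measurable

/-! ### Bounding a function by its derivative -/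

/-- The point `√(1 - a / |z|²) z` on the ray through `z` whose squared modulus is `|z|² - a`. If
`|z|² ≤ a` it is `0`, because the real square root vanishes at negative numbers. -/
noncomputable def radialShift (a : ℝ) (z : ℂ) : ℂ := ((√(1 - a / ‖z‖ ^ 2) : ℝ) : ℂ) * z

theorem radialShift_eq_zero {a : ℝ} {z : ℂ} (h : ‖z‖ ^ 2 ≤ a) : radialShift a z = 0 := by
  rcases eq_or_ne z 0 with rfl | hz
  · simp [radialShift]
  · have : 1 - a / ‖z‖ ^ 2 ≤ 0 := by
      rw [sub_nonpos, one_le_div (by positivity)]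
      exact h
    rw [radialShift, Real.sqrt_eq_zero_of_nonpos this, Complex.ofReal_zero, zero_mul]

theorem norm_radialShift_sq {a : ℝ} (ha : 0 < a) {z : ℂ} (h : a < ‖z‖ ^ 2) :
    ‖radialShift a z‖ ^ 2 = ‖z‖ ^ 2 - a := by
  have hz : 0 < ‖z‖ ^ 2 := ha.trans h
  have h0 : 0 ≤ 1 - a / ‖z‖ ^ 2 := by
    rw [sub_nonneg, div_le_one hz]
    exact h.le
  rw [radialShift, norm_mul, mul_pow, Complex.norm_real, Real.norm_eq_abs, sq_abs,
    Real.sq_sqrt h0, sub_mul, one_mul, div_mul_cancel₀ _ hz.ne']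

theorem norm_radialShift_le {a : ℝ} (ha : 0 < a) (z : ℂ) : ‖radialShift a z‖ ≤ ‖z‖ := by
  have h : √(1 - a / ‖z‖ ^ 2) ≤ 1 := Real.sqrt_le_one.2 (by
    have : 0 ≤ a / ‖z‖ ^ 2 := by positivity
    linarith)
  rw [radialShift, norm_mul, Complex.norm_real, Real.norm_of_nonneg (Real.sqrt_nonneg _)]
  exact mul_le_of_le_one_left (norm_nonneg z) h

/-- The shift has length `O(1 / (1 + |z|))`, also in the core `|z|² ≤ a` that is mapped to `0`. -/
theorem dist_radialShift_le {a : ℝ} (ha : 0 < a) (z : ℂ) :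
    dist (radialShift a z) z ≤ √a * (1 + √a) / (1 + ‖z‖) := by
  have hs : √a ^ 2 = a := Real.sq_sqrt ha.le
  have hs0 : 0 < √a := Real.sqrt_pos.2 ha
  rw [le_div_iff₀ (by positivity), Complex.dist_eq]
  rcases le_or_gt (‖z‖ ^ 2) a with h | h
  · rw [radialShift_eq_zero h, zero_sub, norm_neg]
    have : ‖z‖ ≤ √a := Real.le_sqrt_of_sq_le h
    nlinarith [norm_nonneg z]
  · have hz2 : 0 < ‖z‖ ^ 2 := ha.trans h
    have hz : √a < ‖z‖ := (Real.sqrt_lt' (by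
      by_contra hc
      have := le_antisymm (not_lt.1 hc) (norm_nonneg z)
      simp [this] at hz2)).2 h
    have hz0 := hs0.trans hz
    set t := √(1 - a / ‖z‖ ^ 2) with ht
    have ht0 : 0 ≤ t := Real.sqrt_nonneg _
    have ht2 : t ^ 2 = 1 - a / ‖z‖ ^ 2 := Real.sq_sqrt (by
      rw [sub_nonneg, div_le_one hz2]
      exact h.le)
    have ht1 : t ≤ 1 := by
      have : 0 ≤ a / ‖z‖ ^ 2 := by positivity
      nlinarith
    have h1 : ‖radialShift a z - z‖ = (1 - t) * ‖z‖ := by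
      rw [radialShift, ← sub_one_mul, norm_mul, ← ht, ← Complex.ofReal_one, ← Complex.ofReal_sub,
        Complex.norm_real, Real.norm_eq_abs, abs_sub_comm, abs_of_nonneg (by linarith)]
    have h2 : (1 - t) * ‖z‖ ≤ a / ‖z‖ := by
      have : (1 - t ^ 2) * ‖z‖ = a / ‖z‖ := by
        rw [ht2]; field_simp; ring
      rw [← this]
      gcongr
      nlinarith
    rw [h1]
    calc (1 - t) * ‖z‖ * (1 + ‖z‖) ≤ a / ‖z‖ * (1 + ‖z‖) := by gcongr
      _ = a / ‖z‖ + a := by field_simp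
      _ ≤ a / √a + a := by gcongr
      _ = _ := by rw [Real.div_sqrt]; linarith

theorem exists_norm_sub_le_norm_deriv {h : ℂ → ℂ} (hh : Differentiable ℂ h) (z z' : ℂ) :
    ∃ w, dist w z ≤ dist z' z ∧ ‖h z - h z'‖ ≤ dist z' z * ‖deriv h w‖ := by
  have hc : Continuous (deriv h) := (hh.contDiff (n := 1)).continuous_deriv le_rfl
  have hcomp : IsCompact (segment ℝ z z') := by
    rw [← convexHull_pair]
    exact (Set.toFinite {z, z'}).isCompact_convexHull ℝ
  obtain ⟨w, hw, hmax⟩ := hcomp.exists_isMaxOn ⟨z, left_mem_segment ℝ z z'⟩ hc.norm.continuousOn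
  refine ⟨w, ?_, ?_⟩
  · have := (convex_closedBall z (dist z' z)).segment_subset
      (Metric.mem_closedBall_self dist_nonneg) (Metric.mem_closedBall.2 le_rfl) hw
    exact this
  · rw [norm_sub_rev, mul_comm, Complex.dist_eq]
    have hconv : Convex ℝ (segment ℝ z z') := convex_segment z z'
    exact hconv.norm_image_sub_le_of_norm_deriv_le (fun x _ => hh x)
      (fun x hx => hmax hx) (left_mem_segment ℝ z z') (right_mem_segment ℝ z z')

theorem add_rpow_le_two_rpow_mul {p x y : ℝ} (hp : 0 < p) (hx : 0 ≤ x) (hy : 0 ≤ y) :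
    (x + y) ^ p ≤ 2 ^ p * (x ^ p + y ^ p) := by
  have h1 : (x + y) ^ p ≤ (2 * max x y) ^ p := by
    apply Real.rpow_le_rpow (by positivity) _ hp.le
    linarith [le_max_left x y, le_max_right x y]
  rw [Real.mul_rpow (by norm_num) (by positivity)] at h1
  refine h1.trans ?_
  gcongr
  rcases max_choice x y with h | h <;> rw [h]
  · linarith [Real.rpow_nonneg hy p]
  · linarith [Real.rpow_nonneg hx p]

/-- The other half of the Littlewood–Paley estimate: a function vanishing at `0` is bounded by its
derivative. -/
theorem exists_lintegral_le_deriv {p b : ℝ} (hp : 0 < p) (hb : 0 < b) :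
    ∃ C : ℝ, 0 < C ∧ ∀ h : ℂ → ℂ, Differentiable ℂ h → h 0 = 0 →
      ∫⁻ z, ENNReal.ofReal (‖h z‖ ^ p * fockWeight b 0 z) ≤
        ENNReal.ofReal C * ∫⁻ z, ENNReal.ofReal (‖deriv h z‖ ^ p * fockWeight b (-p) z) := by
  -- this choice of `a` makes the shifted term at most half of the integral to be estimated
  obtain ⟨a, ha, hab⟩ : ∃ a : ℝ, 0 < a ∧ 2 ^ p * Real.exp (-b * a) = 1 / 2 := by
    have hl := Real.log_pos one_lt_two
    refine ⟨(p + 1) * Real.log 2 / b, by positivity, ?_⟩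
    rw [show -b * ((p + 1) * Real.log 2 / b) = Real.log 2 * (-(p + 1)) by field_simp,
      ← Real.rpow_def_of_pos two_pos, ← Real.rpow_add two_pos]
    rw [show p + -(p + 1) = -1 by ring, Real.rpow_neg_one]
    norm_num
  set L := √a * (1 + √a) with hL
  have hL0 : 0 < L := by positivity
  obtain ⟨C₁, hC₁, h1⟩ := exists_rpow_norm_le_localMass (L := L) hp
  obtain ⟨C₂, hC₂, h2⟩ := exists_lintegral_localMass_le p hb.le (by positivity : 0 ≤ L + 1) (-p)
  refine ⟨2 * (2 ^ p * L ^ p * C₁ * C₂), by positivity, fun h hh h00 => ?_⟩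
  have hderiv : Differentiable ℂ (deriv h) := hh.deriv
  set F : ℂ → ℝ≥0∞ := fun z => ENNReal.ofReal (‖h z‖ ^ p * fockWeight b 0 z) with hF
  have hFr : Continuous fun z => ‖h z‖ ^ p * fockWeight b 0 z :=
    (hh.continuous.norm.rpow_const fun _ => Or.inr hp.le).mul (continuous_fockWeight b 0)
  have hFm : Measurable F := hFr.measurable.ennreal_ofReal
  set E : ℂ → ℝ≥0∞ := fun z => ENNReal.ofReal (2 ^ p * L ^ p * C₁) *
    (ENNReal.ofReal (fockWeight b (-p) z) * localMass p (L + 1) (deriv h) z) with hE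
  -- the core `|z|² ≤ a` does not contribute to the first term, because `h 0 = 0`
  have hpt : ∀ z, F z ≤ {z : ℂ | a < ‖z‖ ^ 2}.indicator
      (fun z => 2⁻¹ * F (radialShift a z)) z + E z := by
    intro z
    have hz : 0 < 1 + ‖z‖ := by positivity
    obtain ⟨w, hw, hd⟩ := exists_norm_sub_le_norm_deriv hh z (radialShift a z)
    have hds := dist_radialShift_le ha z
    have h3 := h1 _ hderiv z w (hw.trans hds)
    have h4 : ‖h z‖ ^ p ≤ 2 ^ p * (‖h (radialShift a z)‖ ^ p +
        (L ^ p * ((1 + ‖z‖) ^ (-p) * ‖deriv h w‖ ^ p))) := by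
      have h5 : ‖h z‖ ≤ ‖h (radialShift a z)‖ + L / (1 + ‖z‖) * ‖deriv h w‖ := by
        have h6 := norm_le_norm_add_norm_sub' (h z) (h (radialShift a z))
        have h7 : dist (radialShift a z) z * ‖deriv h w‖ ≤ L / (1 + ‖z‖) * ‖deriv h w‖ := by
          gcongr
        linarith
      refine (Real.rpow_le_rpow (norm_nonneg _) h5 hp.le).trans ?_
      refine (add_rpow_le_two_rpow_mul hp (norm_nonneg _) (by positivity)).trans (le_of_eq ?_)
      rw [Real.mul_rpow (by positivity) (norm_nonneg _), Real.div_rpow hL0.le hz.le,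
        Real.rpow_neg hz.le]
      ring
    have h8 : F z ≤ ENNReal.ofReal (2 ^ p * (‖h (radialShift a z)‖ ^ p * fockWeight b 0 z)) +
        ENNReal.ofReal (2 ^ p * L ^ p * (fockWeight b (-p) z * ‖deriv h w‖ ^ p)) := by
      have hw1 := (fockWeight_pos b 0 z).le
      have hw2 := (fockWeight_pos b (-p) z).le
      rw [← ENNReal.ofReal_add (by positivity) (by positivity)]
      apply ENNReal.ofReal_le_ofReal
      refine (mul_le_mul_of_nonneg_right h4 hw1).trans (le_of_eq ?_)
      simp only [fockWeight, Real.rpow_zero]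
      ring
    refine h8.trans (add_le_add ?_ ?_)
    · by_cases hza : a < ‖z‖ ^ 2
      · rw [Set.indicator_of_mem (by exact hza), ← ENNReal.ofReal_ofNat 2,
          ← ENNReal.ofReal_inv_of_pos two_pos, ← ENNReal.ofReal_mul (by norm_num)]
        apply le_of_eq
        congr 1
        have h9 : fockWeight b 0 z = Real.exp (-b * a) * fockWeight b 0 (radialShift a z) := by
          rw [fockWeight_zero, fockWeight_zero, norm_radialShift_sq ha hza, ← Real.exp_add]
          congr 1
          ring
        rw [h9]
        linear_combination (‖h (radialShift a z)‖ ^ p * fockWeight b 0 (radialShift a z)) * hab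
      · rw [radialShift_eq_zero (not_lt.1 hza), h00, norm_zero, Real.zero_rpow hp.ne']
        simp
    · have hw0 := (fockWeight_pos b (-p) z).le
      simp only [hE]
      rw [ENNReal.ofReal_mul (by positivity), ENNReal.ofReal_mul hw0,
        ENNReal.ofReal_mul (q := C₁) (by positivity),
        mul_assoc (ENNReal.ofReal (2 ^ p * L ^ p)) (ENNReal.ofReal C₁)]
      gcongr _ * ?_
      rw [mul_left_comm]
      gcongr
  have hEint : ∫⁻ z, E z ≤ ENNReal.ofReal (2 ^ p * L ^ p * C₁ * C₂) *
      ∫⁻ z, ENNReal.ofReal (‖deriv h z‖ ^ p * fockWeight b (-p) z) := by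
    rw [hE, lintegral_const_mul' _ _ ENNReal.ofReal_ne_top,
      ENNReal.ofReal_mul (q := C₂) (by positivity), mul_assoc (ENNReal.ofReal _)]
    gcongr _ * ?_
    exact h2 _ hderiv.continuous.measurable
  -- on a disc, which `radialShift` maps into itself, the integral is finite and can be absorbed
  have hball : ∀ R : ℝ, ∫⁻ z in Metric.ball 0 R, F z ≤ 2 * ∫⁻ z, E z := by
    intro R
    set Φ := (Metric.ball (0 : ℂ) R).indicator F with hΦ
    have hΦm : Measurable Φ := hFm.indicator Metric.isOpen_ball.measurableSet
    have hS : MeasurableSet {z : ℂ | a < ‖z‖ ^ 2} := measurableSet_lt (by fun_prop) (by fun_prop)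
    have hpt' : ∀ z, Φ z ≤ {z : ℂ | a < ‖z‖ ^ 2}.indicator
      (fun z => 2⁻¹ * Φ (radialShift a z)) z + E z := by
      intro z
      by_cases hz : z ∈ Metric.ball (0 : ℂ) R
      · have hz' : radialShift a z ∈ Metric.ball (0 : ℂ) R := by
          rw [mem_ball_zero_iff] at hz ⊢
          exact (norm_radialShift_le ha z).trans_lt hz
        have : Φ (radialShift a z) = F (radialShift a z) := Set.indicator_of_mem hz' _
        rw [hΦ, Set.indicator_of_mem hz]
        refine (hpt z).trans (le_of_eq ?_)
        congr 1
        by_cases hza : z ∈ {z : ℂ | a < ‖z‖ ^ 2}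
        · rw [Set.indicator_of_mem hza, Set.indicator_of_mem hza, ← hΦ, this]
        · rw [Set.indicator_of_notMem hza, Set.indicator_of_notMem hza]
      · rw [hΦ, Set.indicator_of_notMem hz]
        exact zero_le
    have hfin : ∫⁻ z, Φ z ≠ ∞ := by
      rw [hΦ, lintegral_indicator Metric.isOpen_ball.measurableSet]
      have hint : IntegrableOn (fun z => ‖h z‖ ^ p * fockWeight b 0 z) (Metric.ball 0 R) :=
        (hFr.continuousOn.integrableOn_compact (isCompact_closedBall 0 R)).mono_set
          Metric.ball_subset_closedBall
      exact hint.lintegral_lt_top.ne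
    have hJ : ∫⁻ z, Φ z ≤ 2⁻¹ * (∫⁻ z, Φ z) + ∫⁻ z, E z := by
      have hsm : Measurable fun z => 2⁻¹ * Φ (radialShift a z) := by
        have : Measurable (radialShift a) := by
          unfold radialShift
          fun_prop
        exact (hΦm.comp this).const_mul _
      calc ∫⁻ z, Φ z ≤ ∫⁻ z, ({z : ℂ | a < ‖z‖ ^ 2}.indicator
            (fun z => 2⁻¹ * Φ (radialShift a z)) z + E z) := lintegral_mono hpt'
        _ = _ := by
          rw [lintegral_add_left (hsm.indicator hS), lintegral_indicator hS,
            lintegral_const_mul' _ _ (by simp)]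
          congr 2
          exact lintegral_comp_radial ha hΦm
    rw [← lintegral_indicator Metric.isOpen_ball.measurableSet, ← hΦ]
    have h10 : 2⁻¹ * ∫⁻ z, Φ z ≤ ∫⁻ z, E z := by
      have : 2⁻¹ * (∫⁻ z, Φ z) + 2⁻¹ * ∫⁻ z, Φ z ≤ 2⁻¹ * (∫⁻ z, Φ z) + ∫⁻ z, E z := by
        rw [← add_mul, ENNReal.inv_two_add_inv_two, one_mul]
        exact hJ
      exact (ENNReal.add_le_add_iff_left (ENNReal.mul_ne_top (by simp) hfin)).1 this
    calc ∫⁻ z, Φ z = 2 * (2⁻¹ * ∫⁻ z, Φ z) := by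
          rw [← mul_assoc, ENNReal.mul_inv_cancel two_ne_zero (by simp), one_mul]
      _ ≤ _ := by gcongr
  have hcov : AECover (volume : Measure ℂ) atTop fun n : ℕ => Metric.ball 0 (n : ℝ) :=
    aecover_ball tendsto_natCast_atTop_atTop
  have hlim := hcov.lintegral_tendsto_of_countably_generated hFm.aemeasurable
  refine (le_of_tendsto' hlim fun n => hball n).trans ?_
  rw [ENNReal.ofReal_mul two_pos.le, ENNReal.ofReal_ofNat, mul_assoc]
  gcongr

/-! ### Theta functions of extremal growth -/

/-- `|θ(z, i)| exp(-π (Im z)²)`, where `θ` is the Jacobi theta function. By the quasi-periodicity of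
`θ` this is doubly periodic with periods `1` and `i`. -/
noncomputable def thetaModulus (z : ℂ) : ℝ :=
  ‖jacobiTheta₂ z Complex.I‖ * Real.exp (-Real.pi * z.im ^ 2)

theorem differentiable_jacobiTheta₂_I : Differentiable ℂ fun z => jacobiTheta₂ z Complex.I :=
  fun z => differentiableAt_jacobiTheta₂_fst z (by simp)

theorem continuous_thetaModulus : Continuous thetaModulus := by
  unfold thetaModulus
  exact differentiable_jacobiTheta₂_I.continuous.norm.mul (by fun_prop)

theorem thetaModulus_add_one (z : ℂ) : thetaModulus (z + 1) = thetaModulus z := by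
  simp [thetaModulus, jacobiTheta₂_add_left]

theorem thetaModulus_add_I (z : ℂ) : thetaModulus (z + Complex.I) = thetaModulus z := by
  have h : (-Real.pi * Complex.I * (Complex.I + 2 * z)).re = Real.pi + 2 * Real.pi * z.im := by
    simp; ring
  rw [thetaModulus, jacobiTheta₂_add_left', norm_mul, Complex.norm_exp, h, thetaModulus,
    mul_right_comm, ← Real.exp_add, mul_comm]
  congr 2
  simp
  ring

theorem thetaModulus_add_intCast (z : ℂ) (m n : ℤ) :
    thetaModulus (z + (m + n * Complex.I)) = thetaModulus z := by
  have h1 : Function.Periodic thetaModulus 1 := thetaModulus_add_one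
  have h2 : Function.Periodic thetaModulus Complex.I := thetaModulus_add_I
  have h3 := h1.int_mul m z
  have h4 := h2.int_mul n (z + m * 1)
  rw [h3, mul_one, add_assoc] at h4
  exact h4

theorem thetaModulus_zero_pos : 0 < thetaModulus 0 := by
  have h := norm_jacobiTheta_sub_one_le (τ := Complex.I) (by simp)
  rw [Complex.I_im, mul_one] at h
  have h1 : Real.exp (-Real.pi) < 1 / 4 := by
    rw [Real.exp_neg, one_div]
    apply inv_strictAnti₀ (by norm_num)
    have := Real.add_one_le_exp Real.pi
    linarith [Real.pi_gt_three]
  have h2 : ‖jacobiTheta Complex.I - 1‖ < 1 := by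
    refine h.trans_lt ?_
    rw [div_mul_eq_mul_div, div_lt_one (by linarith)]
    linarith
  have h3 : jacobiTheta₂ 0 Complex.I ≠ 0 := by
    rw [← jacobiTheta_eq_jacobiTheta₂]
    intro h0
    rw [h0] at h2
    simp at h2
  unfold thetaModulus
  positivity

theorem exists_intCast_sub_mem_cell (z : ℂ) :
    ∃ m n : ℤ, z + (m + n * Complex.I) ∈ Set.Icc (0 : ℝ) 1 ×ℂ Set.Icc (0 : ℝ) 1 := by
  refine ⟨-⌊z.re⌋, -⌊z.im⌋, ?_⟩
  have h1 := Int.floor_le z.re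
  have h2 := Int.lt_floor_add_one z.re
  have h3 := Int.floor_le z.im
  have h4 := Int.lt_floor_add_one z.im
  simp only [Complex.mem_reProdIm, Set.mem_Icc, Int.cast_neg, Complex.add_re, Complex.neg_re,
    Complex.intCast_re, Complex.mul_re, Complex.I_re, Complex.I_im, Complex.neg_im,
    Complex.intCast_im, Complex.add_im, Complex.mul_im]
  refine ⟨⟨?_, ?_⟩, ?_, ?_⟩ <;> linarith

theorem isCompact_unitCell : IsCompact (Set.Icc (0 : ℝ) 1 ×ℂ Set.Icc (0 : ℝ) 1) :=
  isCompact_Icc.reProdIm isCompact_Icc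

theorem exists_thetaModulus_le : ∃ M : ℝ, 0 < M ∧ ∀ z, thetaModulus z ≤ M := by
  obtain ⟨w, -, hmax⟩ := isCompact_unitCell.exists_isMaxOn
    ⟨_, (exists_intCast_sub_mem_cell 0).choose_spec.choose_spec⟩
    continuous_thetaModulus.continuousOn
  have h : ∀ z, thetaModulus z ≤ thetaModulus w := fun z => by
    obtain ⟨m, n, hz⟩ := exists_intCast_sub_mem_cell z
    rw [← thetaModulus_add_intCast z m n]
    exact hmax hz
  exact ⟨thetaModulus w, thetaModulus_zero_pos.trans_le (h 0), h⟩

/-- Finitely many translates of `thetaModulus` have no common zero and are jointly bounded below. -/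
theorem exists_finset_le_thetaModulus : ∃ (s : Finset ℂ) (δ : ℝ), 0 < δ ∧
    ∀ z, ∃ a ∈ s, δ ≤ thetaModulus (z - a) := by
  have h0 := thetaModulus_zero_pos
  obtain ⟨s, hs⟩ := isCompact_unitCell.elim_finite_subcover
    (fun a : ℂ => {z | thetaModulus 0 / 2 < thetaModulus (z - a)})
    (fun a => isOpen_lt continuous_const
      (continuous_thetaModulus.comp (continuous_id.sub continuous_const)))
    (fun a _ => Set.mem_iUnion.2 ⟨a, by
      rw [Set.mem_ofPred_eq, sub_self]
      linarith⟩)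
  refine ⟨s, thetaModulus 0 / 2, by positivity, fun z => ?_⟩
  obtain ⟨m, n, hz⟩ := exists_intCast_sub_mem_cell z
  obtain ⟨a, ha, haz⟩ := Set.mem_iUnion₂.1 (hs hz)
  refine ⟨a, ha, ?_⟩
  rw [← thetaModulus_add_intCast (z - a) m n, sub_add_eq_add_sub]
  exact haz.le

/-- A finite family in the unit ball of `F^∞_α` that jointly attains the maximal growth
`exp(α/2 |z|²)` up to a constant at every point. It consists of normalized Weyl translates of
`exp(α/2 z²) θ(c z, i)` with `π c² = α`. -/
theorem exists_finset_fock_lower_bound {α : ℝ} (hα : 0 < α) :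
    ∃ (s : Finset ℂ) (F : ℂ → ℂ → ℂ) (δ : ℝ), 0 < δ ∧ (∀ a, Differentiable ℂ (F a)) ∧
      (∀ a z, ‖F a z‖ ≤ Real.exp (α / 2 * ‖z‖ ^ 2)) ∧
      ∀ z, ∃ a ∈ s, δ * Real.exp (α / 2 * ‖z‖ ^ 2) ≤ ‖F a z‖ := by
  obtain ⟨M, hM, hle⟩ := exists_thetaModulus_le
  obtain ⟨s, δ, hδ, hge⟩ := exists_finset_le_thetaModulus
  set c : ℝ := √(α / Real.pi) with hc
  have hc2 : Real.pi * c ^ 2 = α := by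
    rw [hc, Real.sq_sqrt (by positivity)]
    field_simp
  have hc0 : 0 < c := by positivity
  set G : ℂ → ℂ → ℂ := fun b z => ((M⁻¹ : ℝ) : ℂ) *
    (jacobiTheta₂ (c * (z - b)) Complex.I *
      Complex.exp ((α / 2 : ℝ) * (2 * z * conj b - conj b * b + (z - b) ^ 2))) with hG
  have hnorm : ∀ b z, ‖G b z‖ =
      M⁻¹ * thetaModulus (c * (z - b)) * Real.exp (α / 2 * ‖z‖ ^ 2) := by
    intro b z
    rw [hG]
    simp only [norm_mul (((M⁻¹ : ℝ) : ℂ)), norm_mul (jacobiTheta₂ _ _), Complex.norm_real,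
      Complex.norm_exp, thetaModulus]
    rw [Real.norm_of_nonneg (by positivity), mul_assoc M⁻¹, mul_assoc ‖jacobiTheta₂ _ _‖,
      ← Real.exp_add]
    congr 3
    rw [Complex.re_ofReal_mul, Complex.im_ofReal_mul, mul_pow, ← mul_assoc, neg_mul, hc2,
      Complex.sq_norm, Complex.normSq_apply]
    simp [pow_two]
    ring
  have hcz : ∀ a z : ℂ, (c : ℂ) * (z - a / c) = c * z - a := fun a z => by
    rw [mul_sub, mul_div_cancel₀ _ (by exact_mod_cast hc0.ne')]
  refine ⟨s, fun a => G (a / c), M⁻¹ * δ, by positivity, fun a => ?_, fun a z => ?_, fun z => ?_⟩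
  · have : Differentiable ℂ fun z : ℂ => jacobiTheta₂ (c * (z - a / c)) Complex.I :=
      differentiable_jacobiTheta₂_I.comp (by fun_prop)
    simp only [hG]
    fun_prop
  · rw [hnorm]
    refine mul_le_of_le_one_left (by positivity) ?_
    rw [inv_mul_le_one₀ hM]
    exact hle _
  · obtain ⟨a, ha, h⟩ := hge (c * z)
    refine ⟨a, ha, ?_⟩
    rw [hnorm, hcz]
    gcongr

/-! ### Normal families and the Volterra operator -/

/-- A form of Montel's theorem: a sequence of entire functions with a common locally bounded
majorant has a subsequence converging pointwise to an entire function. -/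
theorem exists_subseq_tendsto_of_forall_norm_le {B : ℂ → ℝ} (hB : ∀ R, ∃ C, ∀ z, ‖z‖ ≤ R → B z ≤ C)
    {f : ℕ → ℂ → ℂ} (hf : ∀ n, Differentiable ℂ (f n)) (hfB : ∀ n z, ‖f n z‖ ≤ B z) :
    ∃ F : ℂ → ℂ, Differentiable ℂ F ∧ ∃ φ : ℕ → ℕ, StrictMono φ ∧
      ∀ z, Tendsto (fun n => f (φ n) z) atTop (𝓝 (F z)) := by
  choose C hC using hB
  set c : ℕ → ℕ → ℂ := fun n k => (k.factorial : ℂ)⁻¹ * iteratedDeriv k (f n) 0 with hc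
  have hcb : ∀ n k, ∀ R > 0, ‖c n k‖ ≤ C R / R ^ k := by
    intro n k R hR
    have h := Complex.norm_iteratedDeriv_le_of_forall_mem_sphere_norm_le (c := 0) (R := R)
      (C := C R) k hR (hf n).diffContOnCl
      (fun z hz => (hfB n z).trans (hC R z (mem_sphere_zero_iff_norm.1 hz).le))
    have hk : (0 : ℝ) < k.factorial := by positivity
    rw [hc]
    simp only [norm_mul, norm_inv, Complex.norm_natCast]
    rw [inv_mul_le_iff₀ hk, ← mul_div_assoc]
    exact h
  have hsum : ∀ n z, f n z = ∑' k, c n k * z ^ k := fun n z => by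
    have := Complex.taylorSeries_eq_of_entire' 0 z (hf n)
    rw [← this]
    simp [hc]
  -- the Taylor coefficients lie in a product of discs, which is sequentially compact
  have hK : IsCompact (Set.univ.pi fun _ : ℕ => Metric.closedBall (0 : ℂ) (C 1)) :=
    isCompact_univ_pi fun _ => isCompact_closedBall _ _
  obtain ⟨d, -, φ, hφ, hd⟩ := hK.isSeqCompact (x := c) (fun n k _ => by
    simpa using hcb n k 1 one_pos)
  have hdk : ∀ k, Tendsto (fun n => c (φ n) k) atTop (𝓝 (d k)) := tendsto_pi_nhds.1 hd
  have hdb : ∀ k, ∀ R > 0, ‖d k‖ ≤ C R / R ^ k := fun k R hR =>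
    le_of_tendsto' (hdk k).norm fun n => hcb _ k R hR
  have hbound : ∀ R > 0, Summable fun k : ℕ => C (R + 1) * (R / (R + 1)) ^ k := fun R hR =>
    (summable_geometric_of_lt_one (by positivity) (by rw [div_lt_one] <;> linarith)).mul_left _
  have hterm : ∀ R > 0, ∀ z : ℂ, ‖z‖ ≤ R → ∀ (k : ℕ) (x : ℂ), ‖x‖ ≤ C (R + 1) / (R + 1) ^ k →
      ‖x * z ^ k‖ ≤ C (R + 1) * (R / (R + 1)) ^ k := by
    intro R hR z hz k x hx
    rw [norm_mul, norm_pow, div_pow, ← mul_div_assoc, mul_div_right_comm]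
    have := (norm_nonneg x).trans hx
    gcongr
  refine ⟨fun z => ∑' k, d k * z ^ k, fun z => ?_, φ, hφ, fun z => ?_⟩
  · have hR : 0 < ‖z‖ + 1 := by positivity
    have hon := Complex.differentiableOn_tsum_of_summable_norm (hbound _ hR)
      (U := Metric.ball 0 (‖z‖ + 1)) (fun k => by fun_prop) Metric.isOpen_ball
      (fun k w hw => hterm _ hR w (mem_ball_zero_iff.1 hw).le k _ (hdb k _ (by positivity)))
    exact hon.differentiableAt (Metric.isOpen_ball.mem_nhds (by simp))
  · have hR : 0 < ‖z‖ + 1 := by positivity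
    simp only [hsum]
    exact tendsto_tsum_of_dominated_convergence (hbound _ hR)
      (fun k => (hdk k).mul_const _)
      (Eventually.of_forall fun n k => hterm _ hR z (by linarith) k _ (hcb _ k _ (by positivity)))

theorem hasDerivAt_volterra {g h : ℂ → ℂ} (hg : Differentiable ℂ g) (hh : Differentiable ℂ h)
    (z : ℂ) : HasDerivAt (volterra g h) (h z * deriv g z) z := by
  have hd : Differentiable ℂ fun w => h w * deriv g w := hh.mul hg.deriv
  obtain ⟨K, hK⟩ := hd.isExactOn_univ
  have hv : volterra g h = fun z => K z - K 0 := by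
    ext z
    have hseg : ∀ t : ℝ, HasDerivAt (fun t : ℝ => K (t * z))
        (h (t * z) * deriv g (t * z) * z) t := by
      intro t
      have h1 : HasDerivAt (fun t : ℝ => (t : ℂ) * z) z t := by
        simpa using (Complex.ofRealCLM.hasDerivAt (x := t)).mul_const z
      exact (hK (t * z) trivial).comp t h1
    have hcont : Continuous fun t : ℝ => h (t * z) * deriv g (t * z) * z := by
      have := hd.continuous
      exact (this.comp (by fun_prop : Continuous fun t : ℝ => (t : ℂ) * z)).mul continuous_const
    rw [volterra, intervalIntegral.integral_eq_sub_of_hasDerivAt (fun t _ => hseg t)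
      (hcont.intervalIntegrable 0 1)]
    simp
  rw [hv]
  exact (hK z trivial).sub_const _

theorem volterra_zero_right (g h : ℂ → ℂ) : volterra g h 0 = 0 := by
  simp [volterra]

theorem volterraComp_sub {g ψ f₁ f₂ : ℂ → ℂ} (hg : Differentiable ℂ g) (hψ : Differentiable ℂ ψ)
    (hf₁ : Differentiable ℂ f₁) (hf₂ : Differentiable ℂ f₂) :
    volterraComp g ψ f₁ - volterraComp g ψ f₂ = volterraComp g ψ (f₁ - f₂) := by
  ext z
  have hline : Continuous fun t : ℝ => (t : ℂ) * z := by fun_prop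
  have hcont : ∀ f : ℂ → ℂ, Differentiable ℂ f →
      IntervalIntegrable (fun t : ℝ => (f ∘ ψ) (t * z) * deriv g (t * z) * z) volume 0 1 :=
    fun f hf => Continuous.intervalIntegrable
      ((((hf.comp hψ).continuous.comp hline).mul (hg.deriv.continuous.comp hline)).mul
        continuous_const) 0 1
  simp only [volterraComp, volterra, Pi.sub_apply]
  rw [← intervalIntegral.integral_sub (hcont f₁ hf₁) (hcont f₂ hf₂)]
  congr 1
  ext t
  simp only [Function.comp_apply, Pi.sub_apply]
  ring

/-! ### Reduction to integrals of the symbols -/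

/-- The integral of `|f(ψ(z)) g'(z)|^p (1 + |z|)^(-p) exp(-αp/2 |z|²)`, which is comparable to
`‖V_{(g,ψ)} f‖^p`. -/
noncomputable def volterraEnergy (α p : ℝ) (g ψ f : ℂ → ℂ) : ℝ≥0∞ :=
  ∫⁻ z, ENNReal.ofReal (‖f (ψ z) * deriv g z‖ ^ p * fockWeight (α * p / 2) (-p) z)

/-- The integral of `exp(αp/2 |ψ(z)|²) |g'(z)|^p (1 + |z|)^(-p) exp(-αp/2 |z|²)`: the value that the
energy would take if `|f|` were equal to the extremal growth `exp(α/2 |z|²)`. -/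
noncomputable def symbolMass (α p : ℝ) (g ψ : ℂ → ℂ) : ℝ≥0∞ :=
  ∫⁻ z, ENNReal.ofReal (Real.exp (α * p / 2 * ‖ψ z‖ ^ 2) *
    (‖deriv g z‖ ^ p * fockWeight (α * p / 2) (-p) z))

theorem fockENorm_rpow {α p : ℝ} (hp : 0 < p) (f : ℂ → ℂ) :
    fockENorm α p f ^ p = ENNReal.ofReal (α * p / (2 * Real.pi)) *
      ∫⁻ z, ENNReal.ofReal (‖f z‖ ^ p * fockWeight (α * p / 2) 0 z) := by
  rw [fockENorm, ← ENNReal.rpow_mul, one_div_mul_cancel hp.ne', ENNReal.rpow_one]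
  simp only [fockWeight_zero]

theorem exists_fockENorm_volterraComp_comparison {α p : ℝ} (hα : 0 < α) (hp : 0 < p) :
    ∃ c C : ℝ, 0 < c ∧ 0 < C ∧ ∀ g ψ f : ℂ → ℂ,
      Differentiable ℂ g → Differentiable ℂ ψ → Differentiable ℂ f →
      ENNReal.ofReal c * volterraEnergy α p g ψ f ≤ fockENorm α p (volterraComp g ψ f) ^ p ∧
      fockENorm α p (volterraComp g ψ f) ^ p ≤ ENNReal.ofReal C * volterraEnergy α p g ψ f := by
  have hb : 0 < α * p / 2 := by positivity
  have hκ : 0 < α * p / (2 * Real.pi) := by positivity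
  obtain ⟨C₁, hC₁, h1⟩ := exists_lintegral_deriv_le hp hb.le
  obtain ⟨C₂, hC₂, h2⟩ := exists_lintegral_le_deriv hp hb
  refine ⟨α * p / (2 * Real.pi) / C₁, α * p / (2 * Real.pi) * C₂, by positivity, by positivity,
    fun g ψ f hg hψ hf => ?_⟩
  have hder := hasDerivAt_volterra hg (hf.comp hψ)
  have hV : Differentiable ℂ (volterraComp g ψ f) := fun z => (hder z).differentiableAt
  have hE : ∫⁻ z, ENNReal.ofReal (‖deriv (volterraComp g ψ f) z‖ ^ p *
      fockWeight (α * p / 2) (-p) z) = volterraEnergy α p g ψ f :=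
    lintegral_congr fun z => by rw [volterraComp, (hder z).deriv, Function.comp_apply]
  have h3 := h1 _ hV
  have h4 := h2 _ hV (volterra_zero_right _ _)
  rw [hE] at h3 h4
  rw [fockENorm_rpow hp]
  constructor
  · refine (mul_le_mul_right h3 _).trans (le_of_eq ?_)
    rw [← mul_assoc, ← ENNReal.ofReal_mul (by positivity), div_mul_cancel₀ _ hC₁.ne']
  · rw [ENNReal.ofReal_mul hκ.le, mul_assoc]
    gcongr

theorem exp_half_rpow (α p x : ℝ) :
    Real.exp (α / 2 * x) ^ p = Real.exp (α * p / 2 * x) := by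
  rw [← Real.exp_mul]
  congr 1
  ring

theorem energy_integrand_le {α p M : ℝ} (hp : 0 < p) (hM : 0 ≤ M) {ψ f : ℂ → ℂ} (g : ℂ → ℂ)
    (hf : ∀ z, ‖f z‖ ≤ M * Real.exp (α / 2 * ‖z‖ ^ 2)) (z : ℂ) :
    ENNReal.ofReal (‖f (ψ z) * deriv g z‖ ^ p * fockWeight (α * p / 2) (-p) z) ≤
      ENNReal.ofReal (M ^ p) * ENNReal.ofReal (Real.exp (α * p / 2 * ‖ψ z‖ ^ 2) *
        (‖deriv g z‖ ^ p * fockWeight (α * p / 2) (-p) z)) := by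
  rw [← ENNReal.ofReal_mul (by positivity)]
  apply ENNReal.ofReal_le_ofReal
  have h1 : ‖f (ψ z)‖ ^ p ≤ M ^ p * Real.exp (α * p / 2 * ‖ψ z‖ ^ 2) := by
    rw [← exp_half_rpow, ← Real.mul_rpow hM (Real.exp_pos _).le]
    exact Real.rpow_le_rpow (norm_nonneg _) (hf _) hp.le
  have hw := (fockWeight_pos (α * p / 2) (-p) z).le
  rw [norm_mul, Real.mul_rpow (norm_nonneg _) (norm_nonneg _)]
  calc _ ≤ (M ^ p * Real.exp (α * p / 2 * ‖ψ z‖ ^ 2)) * ‖deriv g z‖ ^ p *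
        fockWeight (α * p / 2) (-p) z := by gcongr
    _ = _ := by ring

theorem volterraEnergy_le {α p M : ℝ} (hp : 0 < p) (hM : 0 ≤ M) {g ψ f : ℂ → ℂ}
    (hf : ∀ z, ‖f z‖ ≤ M * Real.exp (α / 2 * ‖z‖ ^ 2)) :
    volterraEnergy α p g ψ f ≤ ENNReal.ofReal (M ^ p) * symbolMass α p g ψ := by
  rw [symbolMass, ← lintegral_const_mul' _ _ ENNReal.ofReal_ne_top]
  exact lintegral_mono (energy_integrand_le hp hM g hf)

theorem measurable_energy_integrand {α p : ℝ} {g ψ f : ℂ → ℂ}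
    (hg : Differentiable ℂ g) (hψ : Differentiable ℂ ψ) (hf : Differentiable ℂ f) :
    Measurable fun z => ENNReal.ofReal
      (‖f (ψ z) * deriv g z‖ ^ p * fockWeight (α * p / 2) (-p) z) :=
  (((((hf.comp hψ).continuous.mul hg.deriv.continuous).norm.measurable).pow_const p).mul
    (continuous_fockWeight _ _).measurable).ennreal_ofReal

theorem symbolMass_le_sum_volterraEnergy {α p δ : ℝ} (hp : 0 < p) (hδ : 0 < δ) {s : Finset ℂ}
    {F : ℂ → ℂ → ℂ} (hF : ∀ a, Differentiable ℂ (F a))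
    (hs : ∀ z, ∃ a ∈ s, δ * Real.exp (α / 2 * ‖z‖ ^ 2) ≤ ‖F a z‖) {g ψ : ℂ → ℂ}
    (hg : Differentiable ℂ g) (hψ : Differentiable ℂ ψ) :
    ENNReal.ofReal (δ ^ p) * symbolMass α p g ψ ≤ ∑ a ∈ s, volterraEnergy α p g ψ (F a) := by
  simp only [volterraEnergy]
  rw [← lintegral_finsetSum _ (fun a _ => measurable_energy_integrand hg hψ (hF a)),
    symbolMass, ← lintegral_const_mul' _ _ ENNReal.ofReal_ne_top]
  refine lintegral_mono fun z => ?_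
  obtain ⟨a, ha, h⟩ := hs (ψ z)
  refine le_trans ?_ (Finset.single_le_sum (f := fun a => ENNReal.ofReal
    (‖F a (ψ z) * deriv g z‖ ^ p * fockWeight (α * p / 2) (-p) z)) (fun _ _ => zero_le) ha)
  rw [← ENNReal.ofReal_mul (by positivity)]
  apply ENNReal.ofReal_le_ofReal
  have h1 := Real.rpow_le_rpow (by positivity) h hp.le
  rw [Real.mul_rpow hδ.le (Real.exp_pos _).le, exp_half_rpow] at h1
  have hw := (fockWeight_pos (α * p / 2) (-p) z).le
  rw [norm_mul, Real.mul_rpow (norm_nonneg _) (norm_nonneg _)]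
  calc _ = (δ ^ p * Real.exp (α * p / 2 * ‖ψ z‖ ^ 2)) * ‖deriv g z‖ ^ p *
        fockWeight (α * p / 2) (-p) z := by ring
    _ ≤ _ := by gcongr

/-- The modulus of the normalized kernel is a Gaussian in `w` centred at `ζ`. -/
theorem norm_fockKernel_rpow (α p : ℝ) (w ζ : ℂ) : ‖fockKernel α w ζ‖ ^ p =
    Real.exp (α * p / 2 * ‖ζ‖ ^ 2) * Real.exp (-(α * p / 2) * ‖w - ζ‖ ^ 2) := by
  rw [fockKernel, Complex.norm_exp, ← Real.exp_mul, ← Real.exp_add]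
  congr 1
  rw [show (α * (ζ * conj w) - α * (‖w‖ : ℂ) ^ 2 / 2 : ℂ) =
    (α : ℝ) * (ζ * conj w) - ((α * ‖w‖ ^ 2 / 2 : ℝ) : ℂ) by push_cast; ring,
    Complex.sub_re, Complex.re_ofReal_mul, Complex.ofReal_re]
  simp only [Complex.sq_norm, Complex.normSq_apply, Complex.mul_re, Complex.conj_re,
    Complex.conj_im, Complex.sub_re, Complex.sub_im]
  ring

theorem lintegral_norm_fockKernel_rpow {α p : ℝ} (hα : 0 < α) (hp : 0 < p) (ζ : ℂ) :
    ∫⁻ w, ENNReal.ofReal (‖fockKernel α w ζ‖ ^ p) =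
      ENNReal.ofReal (2 * Real.pi / (α * p)) * ENNReal.ofReal (Real.exp (α * p / 2 * ‖ζ‖ ^ 2)) := by
  have hb : 0 < α * p / 2 := by positivity
  simp only [norm_fockKernel_rpow]
  have hg := GaussianFourier.integral_rexp_neg_mul_sq_norm (V := ℂ) hb
  rw [Complex.finrank_real_complex, Nat.cast_ofNat, div_self two_ne_zero, Real.rpow_one] at hg
  have hint : Integrable fun w : ℂ => Real.exp (-(α * p / 2) * ‖w‖ ^ 2) := by
    apply Integrable.of_integral_ne_zero
    rw [hg]
    positivity
  rw [lintegral_congr fun w => ENNReal.ofReal_mul (Real.exp_pos _).le,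
    lintegral_const_mul' _ _ ENNReal.ofReal_ne_top,
    lintegral_sub_right_eq_self (fun w : ℂ => ENNReal.ofReal
      (Real.exp (-(α * p / 2) * ‖w‖ ^ 2))) ζ,
    ← ofReal_integral_eq_lintegral_ofReal hint (Eventually.of_forall fun w => (Real.exp_pos _).le),
    hg, mul_comm]
  congr 2
  field_simp

theorem berezin_integrand_eq {α p : ℝ} (g ψ : ℂ → ℂ) (w z : ℂ) :
    ENNReal.ofReal (‖fockKernel α w (ψ z) * deriv g z‖ ^ p /
      ((1 + ‖z‖) * Real.exp (α / 2 * ‖z‖ ^ 2)) ^ p) =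
    ENNReal.ofReal (‖deriv g z‖ ^ p * fockWeight (α * p / 2) (-p) z) *
      ENNReal.ofReal (‖fockKernel α w (ψ z)‖ ^ p) := by
  have hz : 0 < 1 + ‖z‖ := by positivity
  rw [← ENNReal.ofReal_mul (mul_nonneg (by positivity) (fockWeight_pos _ _ z).le), norm_mul,
    Real.mul_rpow (norm_nonneg _) (norm_nonneg _), Real.mul_rpow hz.le (Real.exp_pos _).le,
    exp_half_rpow, fockWeight, Real.rpow_neg hz.le, neg_mul, Real.exp_neg, div_eq_mul_inv, mul_inv]
  congr 1
  ring

theorem measurable_uncurry_berezin {α p : ℝ} {g ψ : ℂ → ℂ} (hg : Differentiable ℂ g)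
    (hψ : Differentiable ℂ ψ) : Measurable (Function.uncurry fun w z : ℂ => ENNReal.ofReal
      (‖fockKernel α w (ψ z) * deriv g z‖ ^ p /
        ((1 + ‖z‖) * Real.exp (α / 2 * ‖z‖ ^ 2)) ^ p)) := by
  have h1 := hψ.continuous.measurable
  have h2 := hg.deriv.continuous.measurable
  have h3 : Measurable fun x : ℂ × ℂ => fockKernel α x.1 (ψ x.2) := by
    unfold fockKernel
    have : Measurable (fun x : ℂ × ℂ => conj x.1) :=
      Complex.continuous_conj.measurable.comp measurable_fst
    fun_prop
  unfold Function.uncurry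
  fun_prop

theorem lintegral_fockBerezin {α p : ℝ} (hα : 0 < α) (hp : 0 < p) {g ψ : ℂ → ℂ}
    (hg : Differentiable ℂ g) (hψ : Differentiable ℂ ψ) :
    ∫⁻ w, fockBerezin α p g ψ w =
      ENNReal.ofReal (2 * Real.pi / (α * p)) * symbolMass α p g ψ := by
  simp only [fockBerezin]
  rw [lintegral_lintegral_swap (measurable_uncurry_berezin hg hψ).aemeasurable, symbolMass,
    ← lintegral_const_mul' _ _ ENNReal.ofReal_ne_top]
  refine lintegral_congr fun z => ?_
  simp only [berezin_integrand_eq]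
  rw [lintegral_const_mul' _ _ ENNReal.ofReal_ne_top, lintegral_norm_fockKernel_rpow hα hp,
    ENNReal.ofReal_mul (Real.exp_pos _).le]
  ring

theorem integrable_fockBerezin_iff {α p : ℝ} (hα : 0 < α) (hp : 0 < p) {g ψ : ℂ → ℂ}
    (hg : Differentiable ℂ g) (hψ : Differentiable ℂ ψ) :
    Integrable (fockBerezin α p g ψ) volume ↔ symbolMass α p g ψ < ∞ := by
  have hm : Measurable (fockBerezin α p g ψ) :=
    (measurable_uncurry_berezin hg hψ).lintegral_prod_right
  have h0 : ENNReal.ofReal (2 * Real.pi / (α * p)) ≠ 0 := by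
    simp only [ne_eq, ENNReal.ofReal_eq_zero, not_le]
    positivity
  rw [Integrable, and_iff_right hm.aestronglyMeasurable, HasFiniteIntegral]
  simp only [enorm_eq_self]
  rw [lintegral_fockBerezin hα hp hg hψ, ENNReal.mul_lt_top_iff]
  simp [h0, ENNReal.ofReal_lt_top]
  intro h
  simp [h]

/-! ### Boundedness, compactness and the operator norm -/

theorem norm_le_of_fockENormTop_le {α : ℝ} {M : ℝ≥0} {f : ℂ → ℂ} (hf : fockENormTop α f ≤ M)
    (z : ℂ) : ‖f z‖ ≤ M * Real.exp (α / 2 * ‖z‖ ^ 2) := by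
  have h : ENNReal.ofReal (‖f z‖ * Real.exp (-(α / 2) * ‖z‖ ^ 2)) ≤ M := (le_iSup
    (fun z => ENNReal.ofReal (‖f z‖ * Real.exp (-(α / 2) * ‖z‖ ^ 2))) z).trans hf
  rw [← ENNReal.ofReal_coe_nnreal, ENNReal.ofReal_le_ofReal_iff M.coe_nonneg, neg_mul,
    Real.exp_neg, ← div_eq_mul_inv, div_le_iff₀ (Real.exp_pos _)] at h
  exact h

theorem fockENormTop_le_of_norm_le {α : ℝ} {M : ℝ≥0} {f : ℂ → ℂ}
    (hf : ∀ z, ‖f z‖ ≤ M * Real.exp (α / 2 * ‖z‖ ^ 2)) : fockENormTop α f ≤ M := by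
  refine iSup_le fun z => ?_
  rw [← ENNReal.ofReal_coe_nnreal, ENNReal.ofReal_le_ofReal_iff M.coe_nonneg, neg_mul,
    Real.exp_neg, ← div_eq_mul_inv, div_le_iff₀ (Real.exp_pos _)]
  exact hf z

/-- If `V_{(g,ψ)}` merely maps `F^∞_α` into `F^p_α`, then `symbolMass` is finite. -/
theorem symbolMass_lt_top {α p : ℝ} (hα : 0 < α) (hp : 0 < p) {g ψ : ℂ → ℂ}
    (hg : Differentiable ℂ g) (hψ : Differentiable ℂ ψ)
    (h : ∀ f ∈ fockSpaceTop α, volterraComp g ψ f ∈ fockSpace α p) :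
    symbolMass α p g ψ < ∞ := by
  obtain ⟨c, C, hc, -, hcC⟩ := exists_fockENorm_volterraComp_comparison hα hp
  obtain ⟨s, F, δ, hδ, hF, hF1, hs⟩ := exists_finset_fock_lower_bound hα
  have hmem : ∀ a, F a ∈ fockSpaceTop α := fun a => ⟨hF a,
    (fockENormTop_le_of_norm_le (M := 1) (by simpa using hF1 a)).trans_lt ENNReal.coe_lt_top⟩
  have hE : ∀ a, volterraEnergy α p g ψ (F a) < ∞ := fun a => by
    have h1 := ((hcC g ψ (F a) hg hψ (hF a)).1).trans_lt
      (ENNReal.rpow_lt_top_of_nonneg hp.le (h _ (hmem a)).2.ne)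
    refine lt_top_iff_ne_top.2 fun h2 => ?_
    rw [h2, ENNReal.mul_top (by simpa using hc)] at h1
    exact h1.ne rfl
  have h3 := (symbolMass_le_sum_volterraEnergy hp hδ hF hs hg hψ).trans_lt
    (ENNReal.sum_lt_top.2 fun a _ => hE a)
  refine lt_top_iff_ne_top.2 fun h2 => ?_
  rw [h2, ENNReal.mul_top (by simpa using Real.rpow_pos_of_pos hδ p)] at h3
  exact h3.ne rfl

theorem fockENorm_volterraComp_le {α p C : ℝ} (hp : 0 < p) {g ψ f : ℂ → ℂ}
    (hC : fockENorm α p (volterraComp g ψ f) ^ p ≤ ENNReal.ofReal C * volterraEnergy α p g ψ f)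
    (hf : fockENormTop α f < ∞) :
    fockENorm α p (volterraComp g ψ f) ≤
      (ENNReal.ofReal C * symbolMass α p g ψ) ^ (1 / p) * fockENormTop α f := by
  obtain ⟨M, hM⟩ : ∃ M : ℝ≥0, (M : ℝ≥0∞) = fockENormTop α f :=
    ⟨_, ENNReal.coe_toNNReal hf.ne⟩
  have h1 := hC.trans (mul_le_mul_right (volterraEnergy_le (g := g) (ψ := ψ) hp M.coe_nonneg
    (norm_le_of_fockENormTop_le hM.ge)) _)
  rw [← hM, ← ENNReal.rpow_le_rpow_iff hp, ENNReal.mul_rpow_of_nonneg _ _ hp.le,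
    ← ENNReal.rpow_mul, one_div_mul_cancel hp.ne', ENNReal.rpow_one]
  refine h1.trans (le_of_eq ?_)
  rw [← ENNReal.ofReal_rpow_of_nonneg M.coe_nonneg hp.le, ENNReal.ofReal_coe_nnreal]
  ring

theorem volterraComp_mem_fockSpace {α p : ℝ} (hα : 0 < α) (hp : 0 < p) {g ψ : ℂ → ℂ}
    (hg : Differentiable ℂ g) (hψ : Differentiable ℂ ψ) (hI : symbolMass α p g ψ < ∞)
    {f : ℂ → ℂ} (hf : f ∈ fockSpaceTop α) : volterraComp g ψ f ∈ fockSpace α p := by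
  obtain ⟨c, C, -, -, hcC⟩ := exists_fockENorm_volterraComp_comparison hα hp
  refine ⟨fun z => (hasDerivAt_volterra hg (hf.1.comp hψ) z).differentiableAt, ?_⟩
  refine (fockENorm_volterraComp_le hp (hcC g ψ f hg hψ hf.1).2 hf.2).trans_lt ?_
  exact ENNReal.mul_lt_top (ENNReal.rpow_lt_top_of_nonneg (by positivity)
    (ENNReal.mul_lt_top ENNReal.ofReal_lt_top hI).ne) hf.2

theorem fockBounded_of_symbolMass_lt_top {α p : ℝ} (hα : 0 < α) (hp : 0 < p) {g ψ : ℂ → ℂ}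
    (hg : Differentiable ℂ g) (hψ : Differentiable ℂ ψ) (hI : symbolMass α p g ψ < ∞) :
    FockBounded α p (volterraComp g ψ) := by
  obtain ⟨c, C, -, -, hcC⟩ := exists_fockENorm_volterraComp_comparison hα hp
  refine ⟨fun f hf => volterraComp_mem_fockSpace hα hp hg hψ hI hf,
    ((ENNReal.ofReal C * symbolMass α p g ψ) ^ (1 / p)).toNNReal, fun f hf => ?_⟩
  rw [ENNReal.coe_toNNReal (ENNReal.rpow_lt_top_of_nonneg (by positivity)
    (ENNReal.mul_lt_top ENNReal.ofReal_lt_top hI).ne).ne]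
  exact fockENorm_volterraComp_le hp (hcC g ψ f hg hψ hf.1).2 hf.2

theorem fockCompact_of_symbolMass_lt_top {α p : ℝ} (hα : 0 < α) (hp : 0 < p) {g ψ : ℂ → ℂ}
    (hg : Differentiable ℂ g) (hψ : Differentiable ℂ ψ) (hI : symbolMass α p g ψ < ∞) :
    FockCompact α p (volterraComp g ψ) := by
  obtain ⟨c, C, -, -, hcC⟩ := exists_fockENorm_volterraComp_comparison hα hp
  refine ⟨fun f hf => volterraComp_mem_fockSpace hα hp hg hψ hI hf, fun f hf ⟨M, hM⟩ => ?_⟩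
  have hfM : ∀ n z, ‖f n z‖ ≤ M * Real.exp (α / 2 * ‖z‖ ^ 2) := fun n =>
    norm_le_of_fockENormTop_le (hM n)
  obtain ⟨F, hF, φ, hφ, hlim⟩ := exists_subseq_tendsto_of_forall_norm_le
    (B := fun z => M * Real.exp (α / 2 * ‖z‖ ^ 2))
    (fun R => ⟨M * Real.exp (α / 2 * R ^ 2), fun z hz => by gcongr⟩) (fun n => (hf n).1) hfM
  have hFM : ∀ z, ‖F z‖ ≤ M * Real.exp (α / 2 * ‖z‖ ^ 2) := fun z =>
    le_of_tendsto' (hlim z).norm fun n => hfM (φ n) z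
  have hFmem : F ∈ fockSpaceTop α :=
    ⟨hF, (fockENormTop_le_of_norm_le hFM).trans_lt ENNReal.coe_lt_top⟩
  refine ⟨volterraComp g ψ F, volterraComp_mem_fockSpace hα hp hg hψ hI hFmem, φ, hφ, ?_⟩
  have hdiff : ∀ n, Differentiable ℂ (f (φ n) - F) := fun n => (hf (φ n)).1.sub hF
  have hbd : ∀ n z, ‖(f (φ n) - F) z‖ ≤ (2 * M) * Real.exp (α / 2 * ‖z‖ ^ 2) := fun n z => by
    have := norm_sub_le (f (φ n) z) (F z)
    rw [Pi.sub_apply]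
    linarith [hfM (φ n) z, hFM z]
  have hE : Tendsto (fun n => volterraEnergy α p g ψ (f (φ n) - F)) atTop (𝓝 0) := by
    have hfin : ∫⁻ z, ENNReal.ofReal ((2 * M : ℝ) ^ p) *
        ENNReal.ofReal (Real.exp (α * p / 2 * ‖ψ z‖ ^ 2) *
          (‖deriv g z‖ ^ p * fockWeight (α * p / 2) (-p) z)) ≠ ∞ := by
      rw [lintegral_const_mul' _ _ ENNReal.ofReal_ne_top]
      exact (ENNReal.mul_lt_top ENNReal.ofReal_lt_top hI).ne
    have := tendsto_lintegral_of_dominated_convergence _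
      (fun n => measurable_energy_integrand (α := α) (p := p) hg hψ (hdiff n))
      (fun n => Eventually.of_forall (energy_integrand_le (p := p) hp
        (by positivity : (0 : ℝ) ≤ 2 * M) g (ψ := ψ) (hbd n))) hfin
      (f := fun _ => 0) (Eventually.of_forall fun z => ?_)
    · simpa [volterraEnergy] using this
    · have h1 : Tendsto (fun n => (f (φ n) - F) (ψ z) * deriv g z) atTop (𝓝 0) := by
        simpa using ((hlim (ψ z)).sub_const (F (ψ z))).mul_const (deriv g z)
      have h2 := ((h1.norm.rpow_const (p := p) (Or.inr hp.le)).mul_const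
        (fockWeight (α * p / 2) (-p) z))
      rw [norm_zero, Real.zero_rpow hp.ne', zero_mul] at h2
      simpa using ENNReal.tendsto_ofReal h2
  have hN : Tendsto (fun n => fockENorm α p (volterraComp g ψ (f (φ n) - F)) ^ p) atTop (𝓝 0) := by
    have hCE := ENNReal.Tendsto.const_mul (a := ENNReal.ofReal C) hE
      (Or.inr ENNReal.ofReal_ne_top)
    rw [mul_zero] at hCE
    exact tendsto_of_tendsto_of_tendsto_of_le_of_le tendsto_const_nhds hCE (fun _ => zero_le)
      fun n => (hcC g ψ _ hg hψ (hdiff n)).2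
  have h3 := hN.ennrpow_const (1 / p)
  rw [ENNReal.zero_rpow_of_pos (by positivity)] at h3
  refine h3.congr fun n => ?_
  rw [← ENNReal.rpow_mul, mul_one_div_cancel hp.ne', ENNReal.rpow_one,
    volterraComp_sub hg hψ (hf (φ n)).1 hF]

theorem fockOpENorm_rpow_le {α p C : ℝ} (hp : 0 < p) {g ψ : ℂ → ℂ}
    (hC : ∀ f, Differentiable ℂ f →
      fockENorm α p (volterraComp g ψ f) ^ p ≤ ENNReal.ofReal C * volterraEnergy α p g ψ f) :
    fockOpENorm α p (volterraComp g ψ) ^ p ≤ ENNReal.ofReal C * symbolMass α p g ψ := by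
  have h : fockOpENorm α p (volterraComp g ψ) ≤
      (ENNReal.ofReal C * symbolMass α p g ψ) ^ (1 / p) := by
    refine iSup₂_le fun f hf => ?_
    refine (fockENorm_volterraComp_le hp (hC f hf.1.1) hf.1.2).trans ?_
    exact mul_le_of_le_one_right zero_le hf.2
  rw [← ENNReal.rpow_le_rpow_iff hp, ← ENNReal.rpow_mul, one_div_mul_cancel hp.ne',
    ENNReal.rpow_one] at h
  exact h

theorem exists_symbolMass_le_fockOpENorm_rpow {α p c : ℝ} (hα : 0 < α) (hp : 0 < p) (hc : 0 < c) :
    ∃ c' : ℝ, 0 < c' ∧ ∀ g ψ : ℂ → ℂ, Differentiable ℂ g → Differentiable ℂ ψ →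
      (∀ f, Differentiable ℂ f →
        ENNReal.ofReal c * volterraEnergy α p g ψ f ≤ fockENorm α p (volterraComp g ψ f) ^ p) →
      ENNReal.ofReal c' * symbolMass α p g ψ ≤ fockOpENorm α p (volterraComp g ψ) ^ p := by
  obtain ⟨s, F, δ, hδ, hF, hF1, hs⟩ := exists_finset_fock_lower_bound hα
  refine ⟨c * δ ^ p / (s.card + 1), by positivity, fun g ψ hg hψ h => ?_⟩
  set N := fockOpENorm α p (volterraComp g ψ) ^ p with hN
  have h1 : ∀ a, ENNReal.ofReal c * volterraEnergy α p g ψ (F a) ≤ N := fun a => by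
    have hle := fockENormTop_le_of_norm_le (M := 1) (by simpa using hF1 a)
    refine (h _ (hF a)).trans (ENNReal.rpow_le_rpow ?_ hp.le)
    exact le_iSup₂_of_le (F a) ⟨⟨hF a, hle.trans_lt ENNReal.coe_lt_top⟩, by simpa using hle⟩ le_rfl
  have h2 : ENNReal.ofReal (c * δ ^ p) * symbolMass α p g ψ ≤
      ENNReal.ofReal (s.card + 1) * N := by
    calc ENNReal.ofReal (c * δ ^ p) * symbolMass α p g ψ
        = ENNReal.ofReal c * (ENNReal.ofReal (δ ^ p) * symbolMass α p g ψ) := by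
          rw [ENNReal.ofReal_mul hc.le, mul_assoc]
      _ ≤ ENNReal.ofReal c * ∑ a ∈ s, volterraEnergy α p g ψ (F a) := by
          gcongr
          exact symbolMass_le_sum_volterraEnergy hp hδ hF hs hg hψ
      _ = ∑ a ∈ s, ENNReal.ofReal c * volterraEnergy α p g ψ (F a) := Finset.mul_sum ..
      _ ≤ ∑ _a ∈ s, N := Finset.sum_le_sum fun a _ => h1 a
      _ = ENNReal.ofReal s.card * N := by
          rw [Finset.sum_const, nsmul_eq_mul, ENNReal.ofReal_natCast]
      _ ≤ _ := by
          gcongr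
          linarith
  rw [div_eq_inv_mul, ENNReal.ofReal_mul (by positivity), mul_assoc,
    ENNReal.ofReal_inv_of_pos (by positivity)]
  rw [ENNReal.inv_mul_le_iff (by simp only [ne_eq, ENNReal.ofReal_eq_zero, not_le]; positivity)
    ENNReal.ofReal_ne_top]
  exact h2

theorem theorem2p3 (α p : ℝ) (hα : 0 < α) (hp : 0 < p) :
    (∀ g ψ : ℂ → ℂ, Differentiable ℂ g → Differentiable ℂ ψ →
      List.TFAE [
        FockBounded α p (volterraComp g ψ),
        FockCompact α p (volterraComp g ψ),
        Integrable (fockBerezin α p g ψ) volume]) ∧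
    ∃ c C : ℝ≥0, 0 < c ∧ 0 < C ∧
      ∀ g ψ : ℂ → ℂ, Differentiable ℂ g → Differentiable ℂ ψ →
        FockBounded α p (volterraComp g ψ) →
          c * ∫⁻ w : ℂ, fockBerezin α p g ψ w ≤ fockOpENorm α p (volterraComp g ψ) ^ p ∧
          fockOpENorm α p (volterraComp g ψ) ^ p ≤ C * ∫⁻ w : ℂ, fockBerezin α p g ψ w := by
  constructor
  · intro g ψ hg hψ
    rw [integrable_fockBerezin_iff hα hp hg hψ]
    tfae_have 1 → 3 := fun h => symbolMass_lt_top hα hp hg hψ h.1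
    tfae_have 2 → 3 := fun h => symbolMass_lt_top hα hp hg hψ h.1
    tfae_have 3 → 1 := fockBounded_of_symbolMass_lt_top hα hp hg hψ
    tfae_have 3 → 2 := fockCompact_of_symbolMass_lt_top hα hp hg hψ
    tfae_finish
  · obtain ⟨c, C, hc, hC, hcC⟩ := exists_fockENorm_volterraComp_comparison hα hp
    obtain ⟨c', hc', hlow⟩ := exists_symbolMass_le_fockOpENorm_rpow hα hp hc
    set G : ℝ := 2 * Real.pi / (α * p) with hG
    have hG0 : 0 < G := by positivity
    refine ⟨(c' / G).toNNReal, (C / G).toNNReal, Real.toNNReal_pos.2 (by positivity),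
      Real.toNNReal_pos.2 (by positivity), fun g ψ hg hψ _ => ?_⟩
    have hcancel : ∀ x : ℝ, 0 ≤ x → ((x / G).toNNReal : ℝ≥0∞) * ∫⁻ w, fockBerezin α p g ψ w =
        ENNReal.ofReal x * symbolMass α p g ψ := fun x hx => by
      change ENNReal.ofReal (x / G) * _ = _
      rw [lintegral_fockBerezin hα hp hg hψ, ← hG, ← mul_assoc,
        ← ENNReal.ofReal_mul (by positivity), div_mul_cancel₀ _ hG0.ne']
    rw [hcancel c' hc'.le, hcancel C hC.le]
    exact ⟨hlow g ψ hg hψ fun f hf => (hcC g ψ f hg hψ hf).1,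
      fockOpENorm_rpow_le hp fun f hf => (hcC g ψ f hg hψ hf).2⟩
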